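/- **Conventions.** Let $R$ be a commutative ring. For a chain map $\varphi:K_\bullet\to L_\bullet$ of complexes of $R$-modules let $\operatorname{Cone}_n(\varphi)=K_{n-1}\oplus L_n$ with $\partial(\theta,\eta)=(\partial\theta,\varphi(\theta)-\partial\eta)$, and $H_n(\varphi):=H_n(\operatorname{Cone}_\bullet(\varphi))$. For a space $X$, $S_\bullet(X)$ is the singular chain complex with coefficients in $R$, and $\widetilde S_\bullet(X)$ is the augmented complex $\cdots\to S_1(X)\to S_0(X)\xrightarrow{\varepsilon}R$, with $\widetilde S_{-1}(X)=R$; its homology is the reduced homology $\widetilde H_\bullet(X)$. With $I=[0,1]$, for a continuous map $f:X\to Y$ let $\operatorname{Cyl}_f=\big((X\times I)\sqcup Y\big)/\big((x,1)\sim f(x)\big)$, $\operatorname{Cone}_f=\operatorname{Cyl}_f/(X\times\{0\})$ and $\operatorname{Cone}(X)=(X\times I)/(X\times\{0\})$, where collapsing a subset $A\subseteq Z$ means identifying $A$ with the extra point $*$ in $Z\sqcup\{*\}$ (the usual quotient if $A\neq\emptyset$). Let $i:Y\to\operatorname{Cone}_f$ and $j:\operatorname{Cone}(X)\to\operatorname{Cone}_f$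 be the natural maps. Let $h:\widetilde S_{n-1}(X)\to\widetilde S_n(\operatorname{Cone}(X))$ send a singular simplex $\sigma:\Delta^{n-1}\to X$ ($n\ge1$) to its cone $\Delta^{n}\to\operatorname{Cone}(X)$, $$(t_0,\dots,t_n)\mapsto\Big[\sigma\Big(\tfrac{(t_1,\dots,t_n)}{1-t_0}\Big),\,1-t_0\Big],\qquad (1,0,\dots,0)\mapsto\text{apex},$$ and let it send $1\in R=\widetilde S_{-1}(X)$ to the apex, viewed as a $0$-simplex. **Theorem.** Let $f:X\to Y$ be a continuous map of topological spaces, let $f_*:\widetilde S_\bullet(X)\to\widetilde S_\bullet(Y)$ be the induced map (the identity of $R$ in degree $-1$), and define, for all $n\ge-1$, $$l_n:\operatorname{Cone}_n(f_*)=\widetilde S_{n-1}(X)\oplus\widetilde S_n(Y)\to\widetilde S_n(\operatorname{Cone}_f),\qquad l_n(x,y)=j_*(h(x))-i_*(y),$$ where $\widetilde S_{-2}(X)=0$. Then: 1. $l_\bullet$ is a chain map up to the usual sign: $l\,\partial+\partial\,l=0$ (equivalently, the maps $(-1)^n l_n$ form a chain map). 2. $l_\bullet$ is a quasi-isomorphism: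 it induces isomorphisms on homology in all degrees. 3. Consequently, writing $H_n(f)$ for the relative homology of $f_*:S_\bullet(X)\to S_\bullet(Y)$ on ordinary singular chains, $H_n(f)\cong\widetilde H_n(\operatorname{Cone}_f)$ for all $n\ge0$; in particular $H_n(f)\cong H_n(\operatorname{Cone}_f)$ for all $n\ge1$. -/

import Mathlib

open CategoryTheory

universe u v

namespace MapCone

/-! ### Topological mapping cylinders and mapping cones -/

section Topology

/-- The space `Z / A` obtained from a space `Z` by collapsing a subset `A` to a point: the quotient
of the disjoint union `Z ⊔ {∗}` in which every point of `A` is identified with `∗`.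
If `A` is nonempty this is the usual quotient of `Z`; as usual, `Z / ∅ = Z ⊔ {∗}`. -/
def Collapse (Z : Type u) [TopologicalSpace Z] (A : Set Z) : Type u :=
  Quot (fun a b : Z ⊕ Unit => ∃ z ∈ A, a = Sum.inl z ∧ b = Sum.inr ())

instance (Z : Type u) [TopologicalSpace Z] (A : Set Z) : TopologicalSpace (Collapse Z A) :=
  inferInstanceAs (TopologicalSpace (Quot _))

/-- The canonical map `Z → Z / A`. -/
def Collapse.mk {Z : Type u} [TopologicalSpace Z] (A : Set Z) : C(Z, Collapse Z A) where
  toFun z := Quot.mk _ (Sum.inl z)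
  continuous_toFun := continuous_quot_mk.comp continuous_inl

/-- The point of `Z / A` to which `A` is collapsed. -/
def Collapse.pt {Z : Type u} [TopologicalSpace Z] (A : Set Z) : Collapse Z A :=
  Quot.mk _ (Sum.inr ())

theorem Collapse.mk_eq_pt {Z : Type u} [TopologicalSpace Z] {A : Set Z} {z : Z} (hz : z ∈ A) :
    Collapse.mk A z = Collapse.pt A :=
  Quot.sound ⟨z, hz, rfl, rfl⟩

/-- The map `Z / A → W / B` induced by a map `g : Z → W` with `g(A) ⊆ B`. -/
def Collapse.map {Z W : Type u} [TopologicalSpace Z] [TopologicalSpace W] {A : Set Z} {B : Set W}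
    (g : C(Z, W)) (hg : Set.MapsTo g A B) : C(Collapse Z A, Collapse W B) where
  toFun := Quot.lift (Sum.elim (fun z => Collapse.mk B (g z)) (fun _ => Collapse.pt B)) (by
    rintro _ _ ⟨z, hz, rfl, rfl⟩
    exact Collapse.mk_eq_pt (hg hz))
  continuous_toFun := continuous_quot_lift _
    (((Collapse.mk B).continuous.comp g.continuous).sumElim continuous_const)

variable {X Y : Type u} [TopologicalSpace X] [TopologicalSpace Y]

/-- The mapping cylinder `((X × I) ⊔ Y) / ((x, 1) ∼ f x)`. -/
def Cyl (f : C(X, Y)) : Type u :=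
  Quot (fun a b : (X × unitInterval) ⊕ Y => ∃ x : X, a = Sum.inl (x, 1) ∧ b = Sum.inr (f x))

instance (f : C(X, Y)) : TopologicalSpace (Cyl f) :=
  inferInstanceAs (TopologicalSpace (Quot _))

/-- The canonical map `X × I → Cyl f`. -/
def Cyl.ofProd (f : C(X, Y)) : C(X × unitInterval, Cyl f) where
  toFun p := Quot.mk _ (Sum.inl p)
  continuous_toFun := continuous_quot_mk.comp continuous_inl

/-- The canonical map `Y → Cyl f`. -/
def Cyl.ofTarget (f : C(X, Y)) : C(Y, Cyl f) where
  toFun y := Quot.mk _ (Sum.inr y)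
  continuous_toFun := continuous_quot_mk.comp continuous_inr

/-- The mapping cone `Cyl f / (X × {0})`. -/
abbrev TopCone (f : C(X, Y)) : Type u :=
  Collapse (Cyl f) (Cyl.ofProd f '' {p | p.2 = 0})

/-- The cone `(X × I) / (X × {0})` on a space `X`. -/
abbrev ConeOn (X : Type u) [TopologicalSpace X] : Type u :=
  Collapse (X × unitInterval) {p | p.2 = 0}

/-- The natural map `i : Y → Cone_f`. -/
def iMap (f : C(X, Y)) : C(Y, TopCone f) :=
  (Collapse.mk _).comp (Cyl.ofTarget f)

/-- The natural map `j : Cone(X) → Cone_f`. -/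
def jMap (f : C(X, Y)) : C(ConeOn X, TopCone f) :=
  Collapse.map (Cyl.ofProd f) (Set.mapsTo_image _ _)

end Topology

/-! ### The cone on a singular simplex -/

section ConeSimplex

/-- The affine map `Δⁿ × I → Δⁿ⁺¹`, `(s, r) ↦ (1 - r, r s₀, …, r sₙ)`. -/
noncomputable def joinMap (n : ℕ) (p : stdSimplex ℝ (Fin (n + 1)) × unitInterval) :
    stdSimplex ℝ (Fin (n + 2)) :=
  ⟨Fin.cons (1 - (p.2 : ℝ)) (fun i => (p.2 : ℝ) * p.1 i), by
    refine ⟨fun i => ?_, ?_⟩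
    · refine Fin.cases ?_ (fun i => ?_) i
      · simpa using p.2.2.2
      · simpa using mul_nonneg p.2.2.1 (stdSimplex.zero_le p.1 i)
    · rw [Fin.sum_univ_succ]
      simp [← Finset.mul_sum, stdSimplex.sum_eq_one]⟩

theorem continuous_joinMap (n : ℕ) : Continuous (joinMap n) := by
  refine Continuous.subtype_mk (continuous_pi fun i => ?_) _
  refine Fin.cases ?_ (fun i => ?_) i
  · simpa using by fun_prop
  · simp only [Fin.cons_succ]
    have h : Continuous fun p : stdSimplex ℝ (Fin (n + 1)) × unitInterval => p.1 i :=
      (continuous_apply i).comp (continuous_subtype_val.comp continuous_fst)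
    fun_prop

/-- The sum `t₁ + ⋯ + tₙ₊₁ = 1 - t₀` of the last barycentric coordinates. -/
noncomputable def height {n : ℕ} (t : stdSimplex ℝ (Fin (n + 2))) : unitInterval :=
  ⟨1 - t 0, by linarith [stdSimplex.le_one t 0], by linarith [stdSimplex.zero_le t 0]⟩

/-- The point `(t₁, …, tₙ₊₁) / (1 - t₀)` of `Δⁿ`, for `t ∈ Δⁿ⁺¹` with `1 - t₀ ≠ 0`. -/
noncomputable def base {n : ℕ} (t : stdSimplex ℝ (Fin (n + 2))) (ht : height t ≠ 0) :
    stdSimplex ℝ (Fin (n + 1)) :=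
  ⟨fun i => t i.succ / (height t : ℝ),
    fun i => div_nonneg (stdSimplex.zero_le t _) (height t).2.1, by
    have h := stdSimplex.sum_eq_one t
    rw [Fin.sum_univ_succ] at h
    have h' : ∑ i : Fin (n + 1), t i.succ = (height t : ℝ) := by
      simp only [height]; linarith
    have h0 : (height t : ℝ) ≠ 0 := fun h => ht (Subtype.ext h)
    rw [← Finset.sum_div, h', div_self h0]⟩

theorem height_joinMap {n : ℕ} (p : stdSimplex ℝ (Fin (n + 1)) × unitInterval) :
    height (joinMap n p) = p.2 := by
  apply Subtype.ext
  change 1 - (1 - (p.2 : ℝ)) = p.2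
  ring

theorem base_joinMap {n : ℕ} (p : stdSimplex ℝ (Fin (n + 1)) × unitInterval)
    (h : height (joinMap n p) ≠ 0) : base (joinMap n p) h = p.1 := by
  apply Subtype.ext
  funext i
  have h0 : (p.2 : ℝ) ≠ 0 := by
    rw [height_joinMap] at h
    exact fun h' => h (Subtype.ext h')
  change ((p.2 : ℝ) * p.1 i) / (height (joinMap n p) : ℝ) = p.1 i
  rw [height_joinMap]
  field_simp

theorem joinMap_surjective (n : ℕ) : Function.Surjective (joinMap n) := by
  intro t
  by_cases ht : height t = 0
  · refine ⟨(Classical.arbitrary _, 0), ?_⟩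
    have h0 : 1 - t 0 = 0 := congrArg Subtype.val ht
    have hs := stdSimplex.sum_eq_one t
    rw [Fin.sum_univ_succ] at hs
    have hz : ∑ i : Fin (n + 1), t i.succ = 0 := by linarith
    rw [Finset.sum_eq_zero_iff_of_nonneg (fun i _ => stdSimplex.zero_le t _)] at hz
    apply Subtype.ext
    funext i
    refine Fin.cases ?_ (fun i => ?_) i
    · change 1 - (0 : ℝ) = t 0
      linarith
    · change (0 : ℝ) * _ = t i.succ
      rw [hz i (Finset.mem_univ _), zero_mul]
  · refine ⟨(base t ht, height t), ?_⟩
    have h0 : (height t : ℝ) ≠ 0 := fun h => ht (Subtype.ext h)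
    apply Subtype.ext
    funext i
    refine Fin.cases ?_ (fun i => ?_) i
    · change 1 - (1 - t 0) = t 0
      ring
    · change (height t : ℝ) * (t i.succ / (height t : ℝ)) = t i.succ
      field_simp

variable {X : Type u} [TopologicalSpace X]

open Classical in
/-- The cone `Δⁿ⁺¹ → Cone(X)` on a singular `n`-simplex `σ` of `X`, with the apex of the cone as
its zeroth vertex:
`(t₀, …, tₙ₊₁) ↦ [σ((t₁, …, tₙ₊₁) / (1 - t₀)), 1 - t₀]`, and `(1, 0, …, 0)` is sent to the apex. -/
noncomputable def coneSimplexFun {n : ℕ} (σ : C(stdSimplex ℝ (Fin (n + 1)), X))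
    (t : stdSimplex ℝ (Fin (n + 2))) : ConeOn X :=
  if ht : height t = 0 then Collapse.pt _ else Collapse.mk _ (σ (base t ht), height t)

theorem coneSimplexFun_joinMap {n : ℕ} (σ : C(stdSimplex ℝ (Fin (n + 1)), X))
    (p : stdSimplex ℝ (Fin (n + 1)) × unitInterval) :
    coneSimplexFun σ (joinMap n p) = Collapse.mk _ (σ p.1, p.2) := by
  unfold coneSimplexFun
  split_ifs with h
  · rw [height_joinMap] at h
    exact (Collapse.mk_eq_pt (A := {p : X × unitInterval | p.2 = 0}) h).symm
  · rw [base_joinMap, height_joinMap]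

theorem continuous_coneSimplexFun {n : ℕ} (σ : C(stdSimplex ℝ (Fin (n + 1)), X)) :
    Continuous (coneSimplexFun σ) := by
  rw [(Topology.IsQuotientMap.of_surjective_continuous (joinMap_surjective n)
    (continuous_joinMap n)).continuous_iff]
  have : coneSimplexFun σ ∘ joinMap n = fun p => Collapse.mk _ (σ p.1, p.2) :=
    funext (coneSimplexFun_joinMap σ)
  rw [this]
  fun_prop

/-- The cone on a singular simplex, as a singular simplex of `Cone(X)`. -/
noncomputable def coneSimplex {n : ℕ} (σ : C(stdSimplex ℝ (Fin (n + 1)), X)) :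
    C(stdSimplex ℝ (Fin (n + 2)), ConeOn X) :=
  ⟨coneSimplexFun σ, continuous_coneSimplexFun σ⟩

end ConeSimplex

/-! ### Algebraic mapping cones -/

section AlgebraicCone

variable {R : Type u} [CommRing R] {K L : ChainComplex (ModuleCat.{v} R) ℕ}

/-- The modules `Cone_n(φ) = K_{n-1} ⊕ L_n` (with `K_{-1} = 0`). -/
def algConeX (K L : ChainComplex (ModuleCat.{v} R) ℕ) : ℕ → ModuleCat.{v} R
  | 0 => L.X 0
  | n + 1 => ModuleCat.of R (K.X n × L.X (n + 1))

/-- The differential `∂(θ, η) = (∂θ, φ(θ) - ∂η)` from `Cone_{n+1}(φ)` to `Cone_n(φ)`. -/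
def algConeD (φ : K ⟶ L) : ∀ n : ℕ, algConeX K L (n + 1) ⟶ algConeX K L n
  | 0 => ModuleCat.ofHom
      ((φ.f 0).hom.comp (LinearMap.fst R _ _) - (L.d 1 0).hom.comp (LinearMap.snd R _ _))
  | n + 1 => ModuleCat.ofHom
      (((K.d (n + 1) n).hom.comp (LinearMap.fst R _ _)).prod
        ((φ.f (n + 1)).hom.comp (LinearMap.fst R _ _) -
          (L.d (n + 2) (n + 1)).hom.comp (LinearMap.snd R _ _)))

theorem algConeD_comp (φ : K ⟶ L) (n : ℕ) : algConeD φ (n + 1) ≫ algConeD φ n = 0 := by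
  have hL (n : ℕ) (y) : (L.d (n + 1) n).hom ((L.d (n + 2) (n + 1)).hom y) = 0 := by
    rw [← ModuleCat.comp_apply, L.d_comp_d]; rfl
  have hK (n : ℕ) (y) : (K.d (n + 1) n).hom ((K.d (n + 2) (n + 1)).hom y) = 0 := by
    rw [← ModuleCat.comp_apply, K.d_comp_d]; rfl
  have hφ (n : ℕ) (x) : (φ.f n).hom ((K.d (n + 1) n).hom x) =
      (L.d (n + 1) n).hom ((φ.f (n + 1)).hom x) := by
    rw [← ModuleCat.comp_apply, ← ModuleCat.comp_apply, φ.comm]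
  apply ModuleCat.hom_ext
  apply LinearMap.ext
  rintro ⟨x, y⟩
  cases n with
  | zero =>
    change (φ.f 0).hom ((K.d 1 0).hom x) -
      (L.d 1 0).hom ((φ.f 1).hom x - (L.d 2 1).hom y) = 0
    rw [map_sub, hL, hφ, sub_zero, sub_self]
  | succ n =>
    refine Prod.ext (hK n x) ?_
    change (φ.f (n + 1)).hom ((K.d (n + 2) (n + 1)).hom x) -
      (L.d (n + 2) (n + 1)).hom ((φ.f (n + 2)).hom x - (L.d (n + 3) (n + 2)).hom y) = 0
    rw [map_sub, hL, hφ, sub_zero, sub_self]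

/-- The algebraic mapping cone of a chain map `φ : K ⟶ L`. -/
def algCone (φ : K ⟶ L) : ChainComplex (ModuleCat.{v} R) ℕ :=
  ChainComplex.of (algConeX K L) (algConeD φ) (algConeD_comp φ)

/-- The relative homology `H_n(φ) = H_n(Cone(φ))` of a chain map. -/
noncomputable abbrev relHomology (φ : K ⟶ L) (n : ℕ) : ModuleCat.{v} R :=
  (algCone φ).homology n

end AlgebraicCone

/-! ### Singular chains, augmented singular chains -/

section Singular

variable (R : Type u) [CommRing R] (X : Type u) [TopologicalSpace X]
  {Y : Type u} [TopologicalSpace Y]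

/-- The singular chain complex `S(X)` with coefficients in `R`. -/
noncomputable abbrev singularChains : ChainComplex (ModuleCat.{u} R) ℕ :=
  (TopCat.toSSet.obj (TopCat.of X)).chainComplex (ModuleCat.of R R)

theorem singularChains_eq : singularChains R X =
    ((AlgebraicTopology.singularChainComplexFunctor (ModuleCat.{u} R)).obj
      (ModuleCat.of R R)).obj (TopCat.of X) := rfl

/-- The singular homology `H_n(X)` with coefficients in `R`. -/
noncomputable abbrev singularHomology (n : ℕ) : ModuleCat.{u} R :=
  (singularChains R X).homology n

variable {X}

/-- The chain map `S(X) ⟶ S(Y)` induced by a continuous map. -/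
noncomputable abbrev singularMap (f : C(X, Y)) : singularChains R X ⟶ singularChains R Y :=
  SSet.chainComplexMap (TopCat.toSSet.map (TopCat.ofHom f)) (ModuleCat.of R R)

/-- The inclusion `R ⟶ S_n(X)` of the summand `R · σ` corresponding to a singular `n`-simplex. -/
noncomputable def ofSimplex {n : ℕ} (σ : C(stdSimplex ℝ (Fin (n + 1)), X)) :
    ModuleCat.of R R ⟶ (singularChains R X).X n :=
  (TopCat.toSSet.obj (TopCat.of X)).ιChainComplex
    (((TopCat.of X).toSSetObjEquiv (.op (SimplexCategory.mk n))).symm σ)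

/-- The homomorphism on `S_n(X)` with prescribed values on the singular `n`-simplices. -/
noncomputable def descSimplex {n : ℕ} {T : ModuleCat.{u} R}
    (g : C(stdSimplex ℝ (Fin (n + 1)), X) → (ModuleCat.of R R ⟶ T)) :
    (singularChains R X).X n ⟶ T :=
  Limits.Sigma.desc fun s : (TopCat.toSSet.obj (TopCat.of X)).obj (.op (SimplexCategory.mk n)) =>
    g ((TopCat.of X).toSSetObjEquiv (.op (SimplexCategory.mk n)) s)

variable (X) in
/-- The augmentation `S_0(X) ⟶ R`, sending every `0`-simplex to `1`. -/
noncomputable def augmentation : (singularChains R X).X 0 ⟶ ModuleCat.of R R :=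
  descSimplex R fun _ => 𝟙 _

theorem ι_descSimplex {n : ℕ} {T : ModuleCat.{u} R}
    (g : C(stdSimplex ℝ (Fin (n + 1)), X) → (ModuleCat.of R R ⟶ T))
    (s : (TopCat.toSSet.obj (TopCat.of X)).obj (.op (SimplexCategory.mk n))) :
    (TopCat.toSSet.obj (TopCat.of X)).ιChainComplex s ≫ descSimplex R g =
      g ((TopCat.of X).toSSetObjEquiv (.op (SimplexCategory.mk n)) s) :=
  Limits.Sigma.ι_desc _ _

theorem ofSimplex_desc {n : ℕ} {T : ModuleCat.{u} R}
    (g : C(stdSimplex ℝ (Fin (n + 1)), X) → (ModuleCat.of R R ⟶ T))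
    (σ : C(stdSimplex ℝ (Fin (n + 1)), X)) :
    ofSimplex R σ ≫ descSimplex R g = g σ := by
  unfold ofSimplex
  rw [ι_descSimplex, Equiv.apply_symm_apply]

theorem d_augmentation : (singularChains R X).d 1 0 ≫ augmentation R X = 0 := by
  apply SSet.chainComplex_hom_ext
  intro s
  rw [SSet.ιChainComplex_d_assoc, Limits.comp_zero, Preadditive.sum_comp]
  simp only [Preadditive.zsmul_comp, augmentation, ι_descSimplex]
  simp [Fin.sum_univ_two]

variable (X) in
/-- The augmented singular chain complex `⋯ ⟶ S_1(X) ⟶ S_0(X) ⟶ R` (so that the reduced chain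
modules are `S̃_n(X) = S_n(X)` for `n ≥ 0`, and `S̃_{-1}(X) = R`).
The indexing is shifted by one: the object of index `k` is `S̃_{k-1}(X)`. -/
noncomputable def augChains : ChainComplex (ModuleCat.{u} R) ℕ :=
  ChainComplex.augment (singularChains R X) (augmentation R X) (d_augmentation R)

variable (X) in
/-- The reduced singular homology `H̃_n(X)`, for `n ≥ 0`. -/
noncomputable abbrev reducedHomology (n : ℕ) : ModuleCat.{u} R :=
  (augChains R X).homology (n + 1)

theorem singularMap_augmentation (f : C(X, Y)) :
    (singularMap R f).f 0 ≫ augmentation R Y = augmentation R X := by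
  apply SSet.chainComplex_hom_ext
  intro s
  rw [SSet.ι_chainComplexMap_f_assoc]
  simp only [augmentation, ι_descSimplex]

/-- The chain map of augmented singular chain complexes induced by a continuous map:
`f_*` on `S_n(X)` for `n ≥ 0`, and the identity of `R` in degree `-1`. -/
noncomputable def augMap (f : C(X, Y)) : augChains R X ⟶ augChains R Y where
  f
    | 0 => 𝟙 (ModuleCat.of R R)
    | n + 1 => (singularMap R f).f n
  comm' i j hij := by
    obtain rfl : j + 1 = i := hij
    cases j with
    | zero =>
      exact (singularMap_augmentation R f).trans (Category.comp_id _).symm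
    | succ n => exact (singularMap R f).comm (n + 1) n

variable (X) in
/-- The map `h : S̃_{n-1}(X) ⟶ S̃_n(Cone(X))` (with `k = n`), replacing each singular simplex by
its cone; in degree `-1` it sends the generator of `S̃_{-1}(X) = R` to the apex of `Cone(X)`. -/
noncomputable def hMap : ∀ k : ℕ, (augChains R X).X k ⟶ (augChains R (ConeOn X)).X (k + 1)
  | 0 => ofSimplex R (n := 0) (ContinuousMap.const _ (Collapse.pt {p : X × unitInterval | p.2 = 0}))
  | _ + 1 => descSimplex R fun σ => ofSimplex R (coneSimplex σ)

/-- The map `l_n : S̃_{n-1}(X) ⊕ S̃_n(Y) ⟶ S̃_n(Cone_f)`, `(x, y) ↦ j_*(h(x)) - i_*(y)`,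
from the algebraic mapping cone of `f_*`, at the index `k = n + 1`. -/
noncomputable def lMap (f : C(X, Y)) :
    ∀ k : ℕ, (algCone (augMap R f)).X k ⟶ (augChains R (TopCone f)).X k
  | 0 => -(augMap R (iMap f)).f 0
  | k + 1 => ModuleCat.ofHom
      ((((augMap R (jMap f)).f (k + 1)).hom.comp (hMap R X k).hom).comp (LinearMap.fst R _ _) -
        ((augMap R (iMap f)).f (k + 1)).hom.comp (LinearMap.snd R _ _))

end Singular

end MapCone

/-! The anticommutation of `l` comes from the boundary formula `∂h = t - h∂` for cones (`bd_coneC`),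
where `t` is induced by the inclusion of the base of `Cone(X)`, together with `j ∘ t = i ∘ f`.

The quasi-isomorphism is proved directly on cycles and boundaries, by excision for the open cover of
`Cone_f` by the open cone `lowerSet` (height different from 1) and the collar `upperSet` (height
above 1/2). The open cone lifts to `Cone(X)` by `sect`, and the collar retracts to `Y` by `retr`.
After enough barycentric subdivisions (`exists_small`) a cycle `z` becomes `u + v` with `u` in the
open cone and `v` in the collar, and `∂u = -∂v` lives in the intersection, which projects to `X`.
The projection of `∂u` is the cycle `x`, and `y` is minus the retraction of `v`. Stretching the
height coordinate is homotopic to the identity; it turns `v` into `i_*` of its retraction and `u`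
into `j_*` of a chain of `Cone(X)` with the same boundary as `h(x)`. Cones have no reduced homology,
so `z` is homologous to `l(x, y)`; this is `exists_cycle_of_topCone`. Injectivity,
`exists_bd_of_topCone`, applies the same cutting to a chain bounding `l(x, y)` and to `h(x)` itself.

All of this takes place in free modules on maps from simplices with `k` vertices. The empty simplex,
`k = 0`, accounts for the augmentation, and `toAug` identifies these modules with the augmented
singular complex. Subdivision and its homotopy are defined on tuples of points, where they are cone
constructions, and carried to singular simplices by naturality. Finally, passing from augmented to
ordinary chains changes the algebraic cone only by an acyclic piece, so the relative homology is
unaffected. -/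

namespace MapCone

/-! ### Tuples of points of a simplex -/

section Affine

/-- The affine map `Δ k → Δ n` with prescribed vertices. -/
noncomputable def aff {k n : ℕ} (w : Fin k → stdSimplex ℝ (Fin n)) :
    C(stdSimplex ℝ (Fin k), stdSimplex ℝ (Fin n)) where
  toFun t := ⟨∑ i, t i • (w i : Fin n → ℝ),
    (convex_stdSimplex ℝ (Fin n)).sum_mem (fun i _ => stdSimplex.zero_le t i)
      (stdSimplex.sum_eq_one t) (fun i _ => (w i).2)⟩
  continuous_toFun := by
    refine Continuous.subtype_mk (continuous_finsetSum _ fun i _ => ?_) _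
    exact ((continuous_apply i).comp continuous_subtype_val).smul continuous_const

theorem aff_coe {k n : ℕ} (w : Fin k → stdSimplex ℝ (Fin n)) (t : stdSimplex ℝ (Fin k)) :
    (aff w t : Fin n → ℝ) = ∑ i, t i • (w i : Fin n → ℝ) := rfl

theorem aff_comp {k n m : ℕ} (v : Fin n → stdSimplex ℝ (Fin m))
    (w : Fin k → stdSimplex ℝ (Fin n)) : (aff v).comp (aff w) = aff (aff v ∘ w) := by
  ext t j
  change (∑ i, (∑ l, t l • (w l : Fin n → ℝ)) i • (v i : Fin m → ℝ)) j =
    (∑ l, t l • (∑ i, w l i • (v i : Fin m → ℝ))) j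
  simp only [Finset.sum_apply, Pi.smul_apply, smul_eq_mul, Finset.sum_mul, Finset.mul_sum]
  rw [Finset.sum_comm]
  simp only [mul_assoc]

theorem aff_vertex (n : ℕ) :
    aff (fun i : Fin n => stdSimplex.vertex (S := ℝ) i) = ContinuousMap.id _ := by
  ext t j
  change (∑ i, t i • ((stdSimplex.vertex (S := ℝ) i : stdSimplex ℝ (Fin n)) : Fin n → ℝ)) j = t j
  simp [Finset.sum_apply, Pi.single_apply]

theorem aff_apply_vertex {k n : ℕ} (w : Fin k → stdSimplex ℝ (Fin n)) (i : Fin k) :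
    aff w (stdSimplex.vertex i) = w i := by
  apply Subtype.ext
  change ∑ j, (stdSimplex.vertex (S := ℝ) i : stdSimplex ℝ (Fin k)) j • (w j : Fin n → ℝ) = w i
  have : ∀ j, (stdSimplex.vertex (S := ℝ) i : stdSimplex ℝ (Fin k)) j = if j = i then 1 else 0 := by
    intro j
    simp [Pi.single_apply]
  simp [this]

/-- The inclusion of the `i`-th face of the simplex with `k + 1` vertices. -/
noncomputable def faceMap {k : ℕ} (i : Fin (k + 1)) :
    C(stdSimplex ℝ (Fin k), stdSimplex ℝ (Fin (k + 1))) :=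
  ⟨stdSimplex.map i.succAbove, stdSimplex.continuous_map _⟩

theorem map_apply_eq {k n : ℕ} (f : Fin k → Fin n) (t : stdSimplex ℝ (Fin k)) (j : Fin n) :
    stdSimplex.map f t j = ∑ i, if f i = j then t i else 0 := by
  rw [stdSimplex.map_coe, FunOnFinite.linearMap_apply_apply, Finset.sum_filter]

theorem aff_comp_faceMap {k n : ℕ} (w : Fin (k + 1) → stdSimplex ℝ (Fin n)) (i : Fin (k + 1)) :
    (aff w).comp (faceMap i) = aff (w ∘ i.succAbove) := by
  ext t j
  change (∑ l, stdSimplex.map i.succAbove t l • (w l : Fin n → ℝ)) j =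
    (∑ l, t l • (w (i.succAbove l) : Fin n → ℝ)) j
  simp only [map_apply_eq, Finset.sum_smul]
  rw [Finset.sum_comm]
  simp [ite_smul]

/-- The barycenter of a nonempty tuple. -/
noncomputable def bary {k n : ℕ} (w : Fin (k + 1) → stdSimplex ℝ (Fin n)) : stdSimplex ℝ (Fin n) :=
  aff w stdSimplex.barycenter

theorem aff_bary {k n m : ℕ} (v : Fin n → stdSimplex ℝ (Fin m))
    (w : Fin (k + 1) → stdSimplex ℝ (Fin n)) : aff v (bary w) = bary (aff v ∘ w) := by
  unfold bary
  rw [← aff_comp]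
  rfl

/-- Closed balls are convex, so a bound on the vertices bounds the whole affine simplex. -/
theorem dist_aff_le {k n : ℕ} {w : Fin k → stdSimplex ℝ (Fin n)} {y : stdSimplex ℝ (Fin n)} {r : ℝ}
    (h : ∀ i, dist (w i) y ≤ r) (t : stdSimplex ℝ (Fin k)) : dist (aff w t) y ≤ r := by
  have hc := convex_closedBall (y : Fin n → ℝ) r
  have := hc.sum_mem (t := Finset.univ) (w := fun i => t i) (z := fun i => (w i : Fin n → ℝ))
    (fun i _ => stdSimplex.zero_le t i) (stdSimplex.sum_eq_one t) (fun i _ => h i)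
  exact this

/-- The vector from the barycenter to `w i` is the average of the `k + 1` differences `w i - w j`,
one of which is zero, giving the factor `k / (k + 1)`. It is weakened to `N / (N + 1)` so that one
ratio serves all faces in an induction on dimension. -/
theorem dist_bary_le {k n N : ℕ} (hk : k ≤ N) {w : Fin (k + 1) → stdSimplex ℝ (Fin n)} {d : ℝ}
    (h : ∀ i j, dist (w i) (w j) ≤ d) (i : Fin (k + 1)) :
    dist (w i) (bary w) ≤ (N / (N + 1) : ℝ) * d := by
  have hd : 0 ≤ d := dist_nonneg.trans (h i i)
  have e : ((w i : Fin n → ℝ) - bary w) =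
      ∑ j ∈ Finset.univ.erase i, ((k + 1 : ℝ)⁻¹) • ((w i : Fin n → ℝ) - w j) := by
    rw [Finset.sum_erase _ (by simp), ← Finset.smul_sum, Finset.sum_sub_distrib, bary, aff_coe]
    simp only [Finset.sum_const, Finset.card_univ, Fintype.card_fin]
    have : ∀ j : Fin (k + 1), (stdSimplex.barycenter : stdSimplex ℝ (Fin (k + 1))) j =
        (k + 1 : ℝ)⁻¹ := by
      intro j
      refine (stdSimplex.barycenter_apply (𝕜 := ℝ) j).trans ?_
      simp
    simp only [this, ← Finset.smul_sum, smul_sub]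
    congr 1
    rw [← Nat.cast_smul_eq_nsmul ℝ, smul_smul]
    push_cast
    rw [inv_mul_cancel₀ (by positivity), one_smul]
  change dist (w i : Fin n → ℝ) (bary w) ≤ _
  rw [dist_eq_norm, e]
  refine (norm_sum_le_of_le (f := fun j => ((k + 1 : ℝ)⁻¹) • ((w i : Fin n → ℝ) - w j))
    (n := fun _ => (k + 1 : ℝ)⁻¹ * d) _ fun j _ => ?_).trans ?_
  · rw [norm_smul, Real.norm_of_nonneg (by positivity), ← dist_eq_norm]
    exact mul_le_mul_of_nonneg_left (h i j) (by positivity)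
  · rw [Finset.sum_const, Finset.card_erase_of_mem (Finset.mem_univ _), Finset.card_univ,
      Fintype.card_fin, Nat.add_sub_cancel, nsmul_eq_mul, ← mul_assoc]
    refine mul_le_mul_of_nonneg_right ?_ hd
    rw [← div_eq_mul_inv, div_le_div_iff₀ (by positivity) (by positivity)]
    have : (k : ℝ) ≤ N := by exact_mod_cast hk
    nlinarith

end Affine

/-! ### Chains of affine simplices -/

section AffineChains

variable (R : Type*) [CommRing R]

/-- Formal combinations of tuples of `k` points of the simplex with `n` vertices. -/
abbrev Tup (k n : ℕ) : Type _ := (Fin k → stdSimplex ℝ (Fin n)) →₀ R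

variable {R} {k n m : ℕ}

/-- The boundary of a tuple. -/
noncomputable def bdT : Tup R (k + 1) n →ₗ[R] Tup R k n :=
  ∑ i : Fin (k + 1), (-1 : R) ^ (i : ℕ) • Finsupp.lmapDomain R R fun w => w ∘ i.succAbove

/-- The cone on a tuple. -/
noncomputable def coneT (b : stdSimplex ℝ (Fin n)) : Tup R k n →ₗ[R] Tup R (k + 1) n :=
  Finsupp.lmapDomain R R fun w => (Fin.cons b w : Fin (k + 1) → stdSimplex ℝ (Fin n))

/-- The action of an affine map on tuples. -/
noncomputable def mapT (g : stdSimplex ℝ (Fin n) → stdSimplex ℝ (Fin m)) :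
    Tup R k n →ₗ[R] Tup R k m :=
  Finsupp.lmapDomain R R fun w => g ∘ w

theorem bdT_single (w : Fin (k + 1) → stdSimplex ℝ (Fin n)) :
    bdT (Finsupp.single w (1 : R)) =
      ∑ i : Fin (k + 1), (-1 : R) ^ (i : ℕ) • Finsupp.single (w ∘ i.succAbove) (1 : R) := by
  simp [bdT, LinearMap.sum_apply]

@[simp]
theorem coneT_single (b : stdSimplex ℝ (Fin n)) (w : Fin k → stdSimplex ℝ (Fin n)) :
    coneT b (Finsupp.single w (1 : R)) = Finsupp.single (Fin.cons b w) 1 := by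
  simp [coneT]

@[simp]
theorem mapT_single (g : stdSimplex ℝ (Fin n) → stdSimplex ℝ (Fin m))
    (w : Fin k → stdSimplex ℝ (Fin n)) :
    mapT g (Finsupp.single w (1 : R)) = Finsupp.single (g ∘ w) 1 := by
  simp [mapT]

theorem mapT_bdT (g : stdSimplex ℝ (Fin n) → stdSimplex ℝ (Fin m)) (c : Tup R (k + 1) n) :
    mapT g (bdT c) = bdT (mapT g c) := by
  induction c using Finsupp.induction_linear with
  | zero => simp
  | add x y hx hy => simp [hx, hy]
  | single w r =>
    rw [← mul_one r, ← smul_eq_mul, ← Finsupp.smul_single, map_smul, map_smul, map_smul, map_smul,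
      mapT_single, bdT_single, bdT_single, map_sum]
    simp only [map_smul, mapT_single, Function.comp_assoc]

theorem mapT_coneT (g : stdSimplex ℝ (Fin n) → stdSimplex ℝ (Fin m)) (b : stdSimplex ℝ (Fin n))
    (c : Tup R k n) : mapT g (coneT b c) = coneT (g b) (mapT g c) := by
  have : (mapT g ∘ₗ coneT b : Tup R k n →ₗ[R] _) = coneT (g b) ∘ₗ mapT g := by
    refine Finsupp.lhom_ext' fun w => LinearMap.ext_ring ?_
    simp only [LinearMap.comp_apply, Finsupp.lsingle_apply, coneT_single, mapT_single]
    congr 1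
    funext i
    refine Fin.cases ?_ (fun i => ?_) i <;> simp
  exact congrArg (· c) this

/-- Deleting the cone point returns the tuple; deleting any other entry gives the cone on a face,
with the sign shifted by one. -/
theorem bdT_coneT (b : stdSimplex ℝ (Fin n)) (c : Tup R (k + 1) n) :
    bdT (coneT b c) = c - coneT b (bdT c) := by
  have : (bdT ∘ₗ coneT b : Tup R (k + 1) n →ₗ[R] _) = LinearMap.id - coneT b ∘ₗ bdT := by
    refine Finsupp.lhom_ext' fun w => LinearMap.ext_ring ?_
    simp only [LinearMap.comp_apply, Finsupp.lsingle_apply, coneT_single, bdT_single,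
      LinearMap.sub_apply, LinearMap.id_apply, map_sum, map_smul]
    rw [Fin.sum_univ_succ, sub_eq_add_neg, ← Finset.sum_neg_distrib]
    congr 1
    · simp only [Fin.val_zero, pow_zero, one_smul]
      congr 1
    · refine Finset.sum_congr rfl fun i _ => ?_
      rw [Fin.val_succ, pow_succ, mul_neg_one, neg_smul]
      congr 3
      funext j
      refine Fin.cases ?_ (fun j => ?_) j <;> simp
  exact congrArg (· c) this

/-- In the lowest degree no correction term exists, since the empty tuple has no boundary. -/
theorem bdT_coneT_zero (b : stdSimplex ℝ (Fin n)) (c : Tup R 0 n) : bdT (coneT b c) = c := by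
  have : (bdT ∘ₗ coneT b : Tup R 0 n →ₗ[R] _) = LinearMap.id := by
    refine Finsupp.lhom_ext' fun w => LinearMap.ext_ring ?_
    simp only [LinearMap.comp_apply, Finsupp.lsingle_apply, coneT_single, bdT_single,
      LinearMap.id_apply]
    simp only [Fin.sum_univ_succ, Finset.univ_eq_empty, Finset.sum_empty, Fin.val_zero, pow_zero,
      one_smul, add_zero]
    congr 1
  exact congrArg (· c) this

theorem single_eq_coneT (w : Fin (k + 1) → stdSimplex ℝ (Fin n)) :
    Finsupp.single w (1 : R) = coneT (w 0) (Finsupp.single (Fin.tail w) 1) := by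
  rw [coneT_single, Fin.cons_self_tail]

/-- Every nonempty tuple is the cone on its tail, so the cone formula and induction replace the
usual cancellation in a double sum. -/
theorem bdT_bdT (c : Tup R (k + 2) n) : bdT (bdT c) = 0 := by
  induction k with
  | zero =>
    have : (bdT ∘ₗ bdT : Tup R 2 n →ₗ[R] _) = 0 := by
      refine Finsupp.lhom_ext' fun w => LinearMap.ext_ring ?_
      simp only [LinearMap.comp_apply, Finsupp.lsingle_apply, LinearMap.zero_apply]
      rw [single_eq_coneT, bdT_coneT, map_sub, bdT_coneT_zero, sub_self]
    exact congrArg (· c) this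
  | succ k ih =>
    have : (bdT ∘ₗ bdT : Tup R (k + 3) n →ₗ[R] _) = 0 := by
      refine Finsupp.lhom_ext' fun w => LinearMap.ext_ring ?_
      simp only [LinearMap.comp_apply, Finsupp.lsingle_apply, LinearMap.zero_apply]
      rw [single_eq_coneT, bdT_coneT, map_sub, bdT_coneT, ih, map_zero, sub_zero, sub_self]
    exact congrArg (· c) this

/-- Barycentric subdivision of tuples. -/
noncomputable def sdT : ∀ k : ℕ, Tup R k n →ₗ[R] Tup R k n
  | 0 => LinearMap.id
  | k + 1 => Finsupp.linearCombination R fun w =>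
      coneT (bary w) (sdT k (bdT (Finsupp.single w 1)))

/-- The homotopy between the identity and barycentric subdivision. -/
noncomputable def hoT : ∀ k : ℕ, Tup R k n →ₗ[R] Tup R (k + 1) n
  | 0 => 0
  | k + 1 => Finsupp.linearCombination R fun w =>
      coneT (bary w) (Finsupp.single w 1 - hoT k (bdT (Finsupp.single w 1)))

theorem sdT_single (w : Fin (k + 1) → stdSimplex ℝ (Fin n)) :
    sdT (k + 1) (Finsupp.single w (1 : R)) =
      coneT (bary w) (sdT k (bdT (Finsupp.single w 1))) := by
  simp [sdT]

theorem hoT_single (w : Fin (k + 1) → stdSimplex ℝ (Fin n)) :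
    hoT (k + 1) (Finsupp.single w (1 : R)) =
      coneT (bary w) (Finsupp.single w 1 - hoT k (bdT (Finsupp.single w 1))) := by
  simp [hoT]

/-- Affine maps preserve barycenters. This naturality is what allows subdivision to be transported
to singular simplices. -/
theorem mapT_sdT (v : Fin n → stdSimplex ℝ (Fin m)) (c : Tup R k n) :
    mapT (aff v) (sdT k c) = sdT k (mapT (aff v) c) := by
  induction k with
  | zero => rfl
  | succ k ih =>
    have : (mapT (aff v) ∘ₗ sdT (k + 1) : Tup R (k + 1) n →ₗ[R] _) =
        sdT (k + 1) ∘ₗ mapT (aff v) := by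
      refine Finsupp.lhom_ext' fun w => LinearMap.ext_ring ?_
      simp only [LinearMap.comp_apply, Finsupp.lsingle_apply]
      rw [mapT_single, sdT_single, sdT_single, mapT_coneT, ih, mapT_bdT, mapT_single, aff_bary]
    exact congrArg (· c) this

theorem mapT_hoT (v : Fin n → stdSimplex ℝ (Fin m)) (c : Tup R k n) :
    mapT (aff v) (hoT k c) = hoT k (mapT (aff v) c) := by
  induction k with
  | zero => simp [hoT]
  | succ k ih =>
    have : (mapT (aff v) ∘ₗ hoT (k + 1) : Tup R (k + 1) n →ₗ[R] _) =
        hoT (k + 1) ∘ₗ mapT (aff v) := by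
      refine Finsupp.lhom_ext' fun w => LinearMap.ext_ring ?_
      simp only [LinearMap.comp_apply, Finsupp.lsingle_apply]
      rw [mapT_single, hoT_single, hoT_single, mapT_coneT, map_sub, ih, mapT_bdT, mapT_single,
        aff_bary]
    exact congrArg (· c) this

theorem bdT_sdT (c : Tup R (k + 1) n) : bdT (sdT (k + 1) c) = sdT k (bdT c) := by
  induction k with
  | zero =>
    have : (bdT ∘ₗ sdT 1 : Tup R 1 n →ₗ[R] _) = sdT 0 ∘ₗ bdT := by
      refine Finsupp.lhom_ext' fun w => LinearMap.ext_ring ?_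
      simp only [LinearMap.comp_apply, Finsupp.lsingle_apply]
      rw [sdT_single, bdT_coneT_zero]
    exact congrArg (· c) this
  | succ k ih =>
    have : (bdT ∘ₗ sdT (k + 2) : Tup R (k + 2) n →ₗ[R] _) = sdT (k + 1) ∘ₗ bdT := by
      refine Finsupp.lhom_ext' fun w => LinearMap.ext_ring ?_
      simp only [LinearMap.comp_apply, Finsupp.lsingle_apply]
      rw [sdT_single, bdT_coneT, ih, bdT_bdT, map_zero, map_zero, sub_zero]
    exact congrArg (· c) this

/-- By induction `w - hoT (∂w)` has boundary `sdT (∂w)`, and the cone on the latter from the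
barycenter is `sdT w`; the cone formula then gives the identity. -/
theorem bdT_hoT (c : Tup R (k + 1) n) :
    bdT (hoT (k + 1) c) + hoT k (bdT c) = c - sdT (k + 1) c := by
  induction k with
  | zero =>
    have : (bdT ∘ₗ hoT 1 + hoT 0 ∘ₗ bdT : Tup R 1 n →ₗ[R] _) = LinearMap.id - sdT 1 := by
      refine Finsupp.lhom_ext' fun w => LinearMap.ext_ring ?_
      simp only [LinearMap.comp_apply, Finsupp.lsingle_apply, LinearMap.add_apply,
        LinearMap.sub_apply, LinearMap.id_apply]
      rw [hoT_single, sdT_single, bdT_coneT]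
      simp [hoT, sdT]
    exact congrArg (· c) this
  | succ k ih =>
    have : (bdT ∘ₗ hoT (k + 2) + hoT (k + 1) ∘ₗ bdT : Tup R (k + 2) n →ₗ[R] _) =
        LinearMap.id - sdT (k + 2) := by
      refine Finsupp.lhom_ext' fun w => LinearMap.ext_ring ?_
      simp only [LinearMap.comp_apply, Finsupp.lsingle_apply, LinearMap.add_apply,
        LinearMap.sub_apply, LinearMap.id_apply]
      have h := ih (bdT (Finsupp.single w (1 : R)))
      rw [bdT_bdT, map_zero, add_zero] at h
      rw [hoT_single, sdT_single, bdT_coneT, map_sub, h, sub_sub_cancel]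
      abel
    exact congrArg (· c) this

end AffineChains

/-! ### The mesh of iterated barycentric subdivisions -/

section Mesh

variable {R : Type*} [CommRing R] {k n : ℕ}

/-- A linear map on formal combinations preserves supports if it does so on generators. -/
theorem mem_supported_of_forall {α β : Type*} {s : Set α} {t : Set β}
    (T : (α →₀ R) →ₗ[R] (β →₀ R))
    (h : ∀ a ∈ s, T (Finsupp.single a 1) ∈ Finsupp.supported R R t) {c : α →₀ R}
    (hc : c ∈ Finsupp.supported R R s) : T c ∈ Finsupp.supported R R t := by
  rw [Finsupp.supported_eq_span_single] at hc
  induction hc using Submodule.span_induction with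
  | mem x hx =>
    obtain ⟨a, ha, rfl⟩ := hx
    exact h a ha
  | zero => simp
  | add x y _ _ hx hy => rw [map_add]; exact add_mem hx hy
  | smul r x _ hx => rw [map_smul]; exact Submodule.smul_mem _ r hx

theorem coneT_mem {s : Set (Fin k → stdSimplex ℝ (Fin n))}
    {t : Set (Fin (k + 1) → stdSimplex ℝ (Fin n))} {b : stdSimplex ℝ (Fin n)}
    (h : ∀ w ∈ s, Fin.cons b w ∈ t) {c : Tup R k n} (hc : c ∈ Finsupp.supported R R s) :
    coneT b c ∈ Finsupp.supported R R t := by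
  refine mem_supported_of_forall _ (fun a ha => ?_) hc
  rw [coneT_single]
  exact Finsupp.single_mem_supported R _ (h a ha)

theorem bdT_mem {s : Set (Fin (k + 1) → stdSimplex ℝ (Fin n))}
    {t : Set (Fin k → stdSimplex ℝ (Fin n))}
    (h : ∀ w ∈ s, ∀ i : Fin (k + 1), w ∘ i.succAbove ∈ t) {c : Tup R (k + 1) n}
    (hc : c ∈ Finsupp.supported R R s) : bdT c ∈ Finsupp.supported R R t := by
  refine mem_supported_of_forall _ (fun a ha => ?_) hc
  rw [bdT_single]
  exact Submodule.sum_mem _ fun i _ =>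
    Submodule.smul_mem _ _ (Finsupp.single_mem_supported R _ (h a ha i))

theorem sdT_mem_ball {y : stdSimplex ℝ (Fin n)} {r : ℝ} {c : Tup R k n}
    (hc : c ∈ Finsupp.supported R R {w | ∀ i, dist (w i) y ≤ r}) :
    sdT k c ∈ Finsupp.supported R R {w | ∀ i, dist (w i) y ≤ r} := by
  induction k with
  | zero => exact hc
  | succ k ih =>
    refine mem_supported_of_forall _ (fun w hw => ?_) hc
    rw [sdT_single]
    refine coneT_mem (s := {w | ∀ i, dist (w i) y ≤ r}) (fun v hv => ?_) (ih ?_)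
    · refine Fin.cases ?_ (fun i => ?_)
      · exact dist_aff_le hw _
      · exact hv i
    · exact bdT_mem (s := {w | ∀ i, dist (w i) y ≤ r})
        (t := {w | ∀ i, dist (w i) y ≤ r}) (fun v hv i j => hv _)
        (Finsupp.single_mem_supported R _ hw)

/-- A subdivided simplex is the barycenter joined to a subdivided face. Distances within the face
shrink by induction, while distances to the barycenter are controlled because subdivision does not
leave a ball containing the original vertices. -/
theorem sdT_mem_mesh {N : ℕ} (hk : k ≤ N + 1) {d : ℝ} {c : Tup R k n}
    (hc : c ∈ Finsupp.supported R R {w | ∀ i j, dist (w i) (w j) ≤ d}) :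
    sdT k c ∈ Finsupp.supported R R {w | ∀ i j, dist (w i) (w j) ≤ (N / (N + 1) : ℝ) * d} := by
  induction k with
  | zero =>
    refine Finsupp.supported_mono ?_ hc
    exact fun w _ i => i.elim0
  | succ k ih =>
    refine mem_supported_of_forall _ (fun w hw => ?_) hc
    have hb := dist_bary_le (by omega : k ≤ N) hw
    have hd : 0 ≤ (N / (N + 1) : ℝ) * d := dist_nonneg.trans (hb 0)
    rw [sdT_single]
    refine coneT_mem (s := {v | ∀ i j, dist (v i) (v j) ≤ (N / (N + 1) : ℝ) * d} ∩
      {v | ∀ i, dist (v i) (bary w) ≤ (N / (N + 1) : ℝ) * d}) (fun v hv => ?_) ?_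
    · refine Fin.cases (Fin.cases ?_ fun j => ?_) (fun i => Fin.cases ?_ fun j => ?_)
      · simpa using hd
      · simpa [dist_comm] using hv.2 j
      · simpa using hv.2 i
      · simpa using hv.1 i j
    · rw [Finsupp.supported_inter]
      refine ⟨ih (by omega) ?_, sdT_mem_ball ?_⟩
      · exact bdT_mem (s := {w | ∀ i j, dist (w i) (w j) ≤ d})
          (t := {w | ∀ i j, dist (w i) (w j) ≤ d}) (fun v hv i j l => hv _ _)
          (Finsupp.single_mem_supported R _ hw)
      · exact bdT_mem (s := {v | ∀ i, dist (v i) (bary w) ≤ (N / (N + 1) : ℝ) * d})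
          (t := {v | ∀ i, dist (v i) (bary w) ≤ (N / (N + 1) : ℝ) * d})
          (fun v hv i j => hv _) (Finsupp.single_mem_supported R _ hb)

theorem sdT_iterate_mem_mesh {N : ℕ} (hk : k ≤ N + 1) {d : ℝ} {c : Tup R k n}
    (hc : c ∈ Finsupp.supported R R {w | ∀ i j, dist (w i) (w j) ≤ d}) (m : ℕ) :
    (sdT k ^ m) c ∈
      Finsupp.supported R R {w | ∀ i j, dist (w i) (w j) ≤ (N / (N + 1) : ℝ) ^ m * d} := by
  induction m with
  | zero => simpa using hc
  | succ m ih =>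
    rw [pow_succ' (sdT k), Module.End.mul_apply, pow_succ' (N / (N + 1) : ℝ), mul_assoc]
    exact sdT_mem_mesh hk ih

end Mesh

/-! ### Singular chains as formal combinations -/

section Chains

variable (R : Type*) [CommRing R]

/-- Formal combinations of singular simplices with `k` vertices. For `k = 0` this is a free module
of rank one, so that these modules form the augmented singular chain complex. -/
abbrev Chains (k : ℕ) (X : Type*) [TopologicalSpace X] : Type _ :=
  C(stdSimplex ℝ (Fin k), X) →₀ R

variable {R} {k l n : ℕ} {X Y Z : Type*} [TopologicalSpace X] [TopologicalSpace Y]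
  [TopologicalSpace Z]

/-- The boundary of a chain. -/
noncomputable def bd : Chains R (k + 1) X →ₗ[R] Chains R k X :=
  ∑ i : Fin (k + 1), (-1 : R) ^ (i : ℕ) • Finsupp.lmapDomain R R fun σ => σ.comp (faceMap i)

/-- The push-forward of chains. -/
noncomputable def push (g : C(X, Y)) : Chains R k X →ₗ[R] Chains R k Y :=
  Finsupp.lmapDomain R R fun σ => g.comp σ

/-- The chain of affine simplices given by a combination of tuples. -/
noncomputable def realize : Tup R k n →ₗ[R] Chains R k (stdSimplex ℝ (Fin n)) :=
  Finsupp.lmapDomain R R aff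

variable (R) in
/-- The tuple of vertices of the simplex. -/
noncomputable def vertices (k : ℕ) : Tup R k k :=
  Finsupp.single (fun i => stdSimplex.vertex i) 1

theorem bd_single (σ : C(stdSimplex ℝ (Fin (k + 1)), X)) :
    bd (Finsupp.single σ (1 : R)) =
      ∑ i : Fin (k + 1), (-1 : R) ^ (i : ℕ) • Finsupp.single (σ.comp (faceMap i)) (1 : R) := by
  simp [bd, LinearMap.sum_apply]

@[simp]
theorem push_single (g : C(X, Y)) (σ : C(stdSimplex ℝ (Fin k), X)) :
    push g (Finsupp.single σ (1 : R)) = Finsupp.single (g.comp σ) 1 := by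
  simp [push]

@[simp]
theorem realize_single (w : Fin k → stdSimplex ℝ (Fin n)) :
    realize (Finsupp.single w (1 : R)) = Finsupp.single (aff w) 1 := by
  simp [realize]

/-- Linear maps which agree on singular simplices agree. -/
theorem chains_ext {M : Type*} [AddCommGroup M] [Module R M] {f g : Chains R k X →ₗ[R] M}
    (h : ∀ σ, f (Finsupp.single σ 1) = g (Finsupp.single σ 1)) (c : Chains R k X) : f c = g c :=
  congrArg (· c) (Finsupp.lhom_ext' fun σ => LinearMap.ext_ring (h σ) : f = g)

theorem push_push (g : C(Y, Z)) (f : C(X, Y)) (c : Chains R k X) :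
    push g (push f c) = push (g.comp f) c :=
  chains_ext (f := push g ∘ₗ push f) (g := push (g.comp f)) (fun σ => by
    simp [ContinuousMap.comp_assoc]) c

theorem push_id (c : Chains R k X) : push (ContinuousMap.id X) c = c :=
  chains_ext (f := push _) (g := LinearMap.id) (fun σ => by simp) c

theorem push_injective {g : C(X, Y)} (hg : Function.Injective g) :
    Function.Injective (push g : Chains R k X →ₗ[R] Chains R k Y) := by
  refine Finsupp.mapDomain_injective fun σ τ h => ?_
  ext t
  exact hg (congrArg (fun φ : C(_, _) => φ t) h)

theorem push_bd (g : C(X, Y)) (c : Chains R (k + 1) X) : push g (bd c) = bd (push g c) :=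
  chains_ext (f := push g ∘ₗ bd) (g := bd ∘ₗ push g) (fun σ => by
    simp only [LinearMap.comp_apply, bd_single, push_single, map_sum, map_smul,
      ContinuousMap.comp_assoc]) c

theorem realize_bdT (c : Tup R (k + 1) n) : realize (bdT c) = bd (realize c) := by
  have : (realize ∘ₗ bdT : Tup R (k + 1) n →ₗ[R] _) = bd ∘ₗ realize := by
    refine Finsupp.lhom_ext' fun w => LinearMap.ext_ring ?_
    simp only [LinearMap.comp_apply, Finsupp.lsingle_apply, bd_single, bdT_single, realize_single,
      map_sum, map_smul, aff_comp_faceMap]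
  exact congrArg (· c) this

theorem push_realize {m : ℕ} (v : Fin n → stdSimplex ℝ (Fin m)) (c : Tup R k n) :
    push (aff v) (realize c) = realize (mapT (aff v) c) := by
  have : (push (aff v) ∘ₗ realize : Tup R k n →ₗ[R] _) = realize ∘ₗ mapT (aff v) := by
    refine Finsupp.lhom_ext' fun w => LinearMap.ext_ring ?_
    simp [aff_comp]
  exact congrArg (· c) this

theorem realize_vertices (k : ℕ) :
    realize (vertices R k) = Finsupp.single (ContinuousMap.id _) 1 := by
  rw [vertices, realize_single, aff_vertex]

theorem single_eq_push (σ : C(stdSimplex ℝ (Fin k), X)) :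
    Finsupp.single σ (1 : R) = push σ (realize (vertices R k)) := by
  rw [realize_vertices, push_single, ContinuousMap.comp_id]

/-- The natural operation on singular chains defined by a chain of tuples in the simplex. -/
noncomputable def natOp (c : Tup R l k) : Chains R k X →ₗ[R] Chains R l X :=
  Finsupp.linearCombination R fun σ => push σ (realize c)

theorem natOp_single (c : Tup R l k) (σ : C(stdSimplex ℝ (Fin k), X)) :
    natOp c (Finsupp.single σ (1 : R)) = push σ (realize c) := by
  simp [natOp]

theorem push_natOp (c : Tup R l k) (g : C(X, Y)) (x : Chains R k X) :
    push g (natOp c x) = natOp c (push g x) :=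
  chains_ext (f := push g ∘ₗ natOp c) (g := natOp c ∘ₗ push g) (fun σ => by
    simp [natOp_single, push_push]) x

/-- An affine simplex is the image of the standard one under `aff w`, so an operation natural for
affine maps is determined by its value on the tuple of vertices. -/
theorem natOp_realize (T : ∀ n, Tup R k n →ₗ[R] Tup R l n)
    (hT : ∀ {n m} (v : Fin n → stdSimplex ℝ (Fin m)) (c : Tup R k n),
      mapT (aff v) (T n c) = T m (mapT (aff v) c)) (c : Tup R k n) :
    natOp (T k (vertices R k)) (realize c) = realize (T n c) := by
  have : (natOp (T k (vertices R k)) ∘ₗ realize : Tup R k n →ₗ[R] _) = realize ∘ₗ T n := by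
    refine Finsupp.lhom_ext' fun w => LinearMap.ext_ring ?_
    simp only [LinearMap.comp_apply, Finsupp.lsingle_apply, realize_single, natOp_single]
    rw [push_realize, hT, vertices, mapT_single]
    congr 3
    funext i
    exact aff_apply_vertex w i
  exact congrArg (· c) this

/-- Barycentric subdivision of singular chains. -/
noncomputable def sd : Chains R k X →ₗ[R] Chains R k X := natOp (sdT k (vertices R k))

/-- The natural homotopy between the identity and barycentric subdivision. -/
noncomputable def ho : Chains R k X →ₗ[R] Chains R (k + 1) X := natOp (hoT k (vertices R k))

theorem push_sd (g : C(X, Y)) (x : Chains R k X) : push g (sd x) = sd (push g x) :=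
  push_natOp _ g x

theorem push_ho (g : C(X, Y)) (x : Chains R k X) : push g (ho x) = ho (push g x) :=
  push_natOp _ g x

theorem sd_realize (c : Tup R k n) : sd (realize c) = realize (sdT k c) :=
  natOp_realize (fun _ => sdT k) (fun v c => mapT_sdT v c) c

theorem ho_realize (c : Tup R k n) : ho (realize c) = realize (hoT k c) :=
  natOp_realize (fun _ => hoT k) (fun v c => mapT_hoT v c) c

theorem bd_bd (c : Chains R (k + 2) X) : bd (bd c) = 0 :=
  chains_ext (f := bd ∘ₗ bd) (g := 0) (fun σ => by
    rw [single_eq_push, LinearMap.comp_apply, ← push_bd, ← push_bd, ← realize_bdT, ← realize_bdT,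
      bdT_bdT]
    simp) c

/-- Both sides are natural, so it suffices to compare them on the identity simplex, where the
identity is the one for tuples. -/
theorem bd_sd (c : Chains R (k + 1) X) : bd (sd c) = sd (bd c) :=
  chains_ext (f := bd ∘ₗ sd) (g := sd ∘ₗ bd) (fun σ => by
    rw [single_eq_push, LinearMap.comp_apply, LinearMap.comp_apply, ← push_bd, ← push_sd,
      ← push_sd, ← push_bd, sd_realize, ← realize_bdT, ← realize_bdT, sd_realize, bdT_sdT]) c

theorem bd_ho (c : Chains R (k + 1) X) : bd (ho c) + ho (bd c) = c - sd c :=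
  chains_ext (f := bd ∘ₗ ho + ho ∘ₗ bd) (g := LinearMap.id - sd) (fun σ => by
    simp only [LinearMap.add_apply, LinearMap.sub_apply, LinearMap.comp_apply, LinearMap.id_apply]
    rw [single_eq_push, ← push_bd, ← push_sd, ← push_ho, ← push_ho, ← push_bd, ← map_add,
      ← map_sub, sd_realize, ho_realize, ← realize_bdT, ← realize_bdT, ho_realize, ← map_add,
      ← map_sub, bdT_hoT]) c

theorem sd_zero (c : Chains R 0 X) : sd c = c :=
  chains_ext (f := sd) (g := LinearMap.id) (fun σ => by
    rw [single_eq_push, ← push_sd, sd_realize]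
    rfl) c

theorem ho_zero (c : Chains R 0 X) : ho c = 0 :=
  chains_ext (f := ho) (g := 0) (fun σ => by
    rw [single_eq_push, ← push_ho, ho_realize]
    simp [hoT]) c

/-- Iterated barycentric subdivision. -/
noncomputable def sdN (m : ℕ) : Chains R k X →ₗ[R] Chains R k X := sd ^ m

/-- The natural homotopy between the identity and iterated barycentric subdivision. -/
noncomputable def hoN : ℕ → (Chains R k X →ₗ[R] Chains R (k + 1) X)
  | 0 => 0
  | m + 1 => hoN m + ho ∘ₗ sdN m

theorem sdN_succ (m : ℕ) (c : Chains R k X) : sdN (m + 1) c = sd (sdN m c) := by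
  rw [sdN, pow_succ', Module.End.mul_apply, sdN]

theorem hoN_succ (m : ℕ) (c : Chains R k X) : hoN (m + 1) c = hoN m c + ho (sdN m c) := rfl

theorem push_sdN (m : ℕ) (g : C(X, Y)) (x : Chains R k X) :
    push g (sdN m x) = sdN m (push g x) := by
  induction m with
  | zero => rfl
  | succ m ih => rw [sdN_succ, sdN_succ, push_sd, ih]

theorem push_hoN (m : ℕ) (g : C(X, Y)) (x : Chains R k X) :
    push g (hoN m x) = hoN m (push g x) := by
  induction m with
  | zero => simp [hoN]
  | succ m ih => rw [hoN_succ, hoN_succ, map_add, ih, push_ho, push_sdN]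

theorem bd_sdN (m : ℕ) (c : Chains R (k + 1) X) : bd (sdN m c) = sdN m (bd c) := by
  induction m with
  | zero => rfl
  | succ m ih => rw [sdN_succ, sdN_succ, bd_sd, ih]

theorem bd_hoN (m : ℕ) (c : Chains R (k + 1) X) :
    bd (hoN m c) + hoN m (bd c) = c - sdN m c := by
  induction m with
  | zero => simp [hoN, sdN]
  | succ m ih =>
    have h := bd_ho (sdN m c)
    rw [bd_sdN] at h
    rw [hoN_succ, hoN_succ, sdN_succ, map_add, add_add_add_comm, ih, h]
    abel

theorem sdN_zero (m : ℕ) (c : Chains R 0 X) : sdN m c = c := by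
  induction m with
  | zero => rfl
  | succ m ih => rw [sdN_succ, ih, sd_zero]

theorem hoN_zero (m : ℕ) (c : Chains R 0 X) : hoN m c = 0 := by
  induction m with
  | zero => simp [hoN]
  | succ m ih => rw [hoN_succ, ih, ho_zero, add_zero]

theorem sdN_realize (m : ℕ) (c : Tup R k n) : sdN m (realize c) = realize ((sdT k ^ m) c) := by
  induction m with
  | zero => rfl
  | succ m ih => rw [sdN_succ, ih, sd_realize, pow_succ', Module.End.mul_apply]

/-- A chain is a cycle if its boundary vanishes; there is no condition in the lowest degree. -/
def IsCyc : ∀ {k : ℕ}, Chains R k X → Prop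
  | 0, _ => True
  | _ + 1, c => bd c = 0

theorem isCyc_bd (c : Chains R (k + 1) X) : IsCyc (bd c) := by
  cases k with
  | zero => trivial
  | succ k => exact bd_bd c

theorem isCyc_push {c : Chains R k X} (hc : IsCyc c) (g : C(X, Y)) : IsCyc (push g c) := by
  cases k with
  | zero => trivial
  | succ k =>
    change bd _ = 0
    rw [← push_bd, show bd c = 0 from hc, map_zero]

theorem isCyc_of_push {g : C(X, Y)} (hg : Function.Injective g) {c : Chains R k X}
    (hc : IsCyc (push g c)) : IsCyc c := by
  cases k with
  | zero => trivial
  | succ k =>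
    refine push_injective (R := R) hg ?_
    rw [push_bd, map_zero]
    exact hc

theorem isCyc_sdN {c : Chains R k X} (hc : IsCyc c) (m : ℕ) : IsCyc (sdN m c) := by
  cases k with
  | zero => trivial
  | succ k =>
    change bd _ = 0
    rw [bd_sdN, show bd c = 0 from hc, map_zero]

/-- A cycle is homologous to its iterated subdivisions. -/
theorem IsCyc.bd_hoN {c : Chains R k X} (hc : IsCyc c) (m : ℕ) : bd (hoN m c) = c - sdN m c := by
  cases k with
  | zero => rw [hoN_zero, sdN_zero, map_zero, sub_self]
  | succ k =>
    have := MapCone.bd_hoN m c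
    rwa [show bd c = 0 from hc, map_zero, add_zero] at this

end Chains

/-! ### Small chains -/

section Small

variable {R : Type*} [CommRing R] {k : ℕ} {X Y : Type*} [TopologicalSpace X] [TopologicalSpace Y]

/-- The inclusion of a subspace. -/
def incl (s : Set X) : C(s, X) := ⟨Subtype.val, continuous_subtype_val⟩

theorem incl_injective (s : Set X) : Function.Injective (incl s) := Subtype.val_injective

/-- The chains supported in a subset are the chains of the subspace. -/
theorem exists_push_incl {s : Set X} {c : Chains R k X}
    (hc : c ∈ Finsupp.supported R R {σ | ∀ t, σ t ∈ s}) : ∃ c', push (incl s) c' = c := by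
  rw [Finsupp.supported_eq_span_single] at hc
  induction hc using Submodule.span_induction with
  | mem x hx =>
    obtain ⟨σ, hσ, rfl⟩ := hx
    refine ⟨Finsupp.single ⟨fun t => ⟨σ t, hσ t⟩, by fun_prop⟩ 1, ?_⟩
    rw [push_single]
    rfl
  | zero => exact ⟨0, map_zero _⟩
  | add x y _ _ hx hy =>
    obtain ⟨a, rfl⟩ := hx
    obtain ⟨b, rfl⟩ := hy
    exact ⟨a + b, map_add _ _ _⟩
  | smul r x _ hx =>
    obtain ⟨a, rfl⟩ := hx
    exact ⟨r • a, map_smul _ _ _⟩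

theorem push_incl_mem {s : Set X} (c : Chains R k s) :
    push (incl s) c ∈ Finsupp.supported R R {σ : C(stdSimplex ℝ (Fin k), X) | ∀ t, σ t ∈ s} := by
  refine mem_supported_of_forall (s := Set.univ) _ (fun σ _ => ?_) (by simp)
  rw [push_single]
  exact Finsupp.single_mem_supported R _ fun t => (σ t).2

/-- Chains of two subspaces with the same image come from the intersection. -/
theorem exists_of_push_eq {s t : Set X} {c : Chains R k s} {d : Chains R k t}
    (h : push (incl s) c = push (incl t) d) :
    ∃ e : Chains R k (s ∩ t : Set X), push (incl (s ∩ t)) e = push (incl s) c := by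
  refine exists_push_incl ?_
  have : {σ : C(stdSimplex ℝ (Fin k), X) | ∀ x, σ x ∈ s ∩ t} =
      {σ | ∀ x, σ x ∈ s} ∩ {σ | ∀ x, σ x ∈ t} := by
    ext σ
    exact forall_and
  rw [this, Finsupp.supported_inter]
  exact ⟨push_incl_mem c, h ▸ push_incl_mem d⟩

/-- Every chain becomes small with respect to an open cover by two sets after sufficiently many
subdivisions. -/
theorem exists_small {s t : Set X} (hs : IsOpen s) (ht : IsOpen t) (hst : s ∪ t = Set.univ)
    (c : Chains R k X) : ∃ N, ∀ m ≥ N, ∃ (u : Chains R k s) (v : Chains R k t),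
      sdN m c = push (incl s) u + push (incl t) v := by
  induction c using Finsupp.induction_linear with
  | zero => exact ⟨0, fun m _ => ⟨0, 0, by simp⟩⟩
  | add x y hx hy =>
    obtain ⟨N, hN⟩ := hx
    obtain ⟨M, hM⟩ := hy
    refine ⟨max N M, fun m hm => ?_⟩
    obtain ⟨u, v, h⟩ := hN m ((le_max_left _ _).trans hm)
    obtain ⟨u', v', h'⟩ := hM m ((le_max_right _ _).trans hm)
    exact ⟨u + u', v + v', by rw [map_add, h, h', map_add, map_add]; abel⟩
  | single σ r =>
    -- A Lebesgue number for the cover of the compact simplex pulled back along `σ`; the mesh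
    -- eventually drops below it.
    obtain ⟨δ, hδ, hb⟩ := lebesgue_number_lemma_of_metric (s := Set.univ)
      (c := fun b : Bool => σ ⁻¹' (cond b s t)) isCompact_univ
      (fun b => (show IsOpen (cond b s t) by cases b <;> assumption).preimage σ.continuous)
      (fun x _ => by
        have : σ x ∈ s ∪ t := hst ▸ Set.mem_univ _
        rw [Set.mem_iUnion]
        rcases this with h | h
        · exact ⟨true, h⟩
        · exact ⟨false, h⟩)
    have hlim : Filter.Tendsto (fun m : ℕ => (k / (k + 1) : ℝ) ^ m * 1) Filter.atTop (nhds 0) := by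
      simpa using tendsto_pow_atTop_nhds_zero_of_lt_one (by positivity : 0 ≤ (k / (k + 1) : ℝ))
        (by rw [div_lt_one (by positivity)]; linarith)
    obtain ⟨N, hN⟩ := Filter.eventually_atTop.1 (hlim.eventually (gt_mem_nhds hδ))
    refine ⟨N, fun m hm => ?_⟩
    have h1 : sdN m (Finsupp.single σ (1 : R)) ∈
        Finsupp.supported R R ({τ : C(stdSimplex ℝ (Fin k), X) | ∀ x, τ x ∈ s} ∪
          {τ | ∀ x, τ x ∈ t}) := by
      rw [single_eq_push, ← push_sdN, sdN_realize, ← LinearMap.comp_apply]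
      refine mem_supported_of_forall _ (fun w hw => ?_)
        (sdT_iterate_mem_mesh (N := k) (d := 1) (by omega) (Finsupp.single_mem_supported R _ ?_) m)
      · rw [LinearMap.comp_apply, realize_single, push_single]
        refine Finsupp.single_mem_supported R _ ?_
        -- The empty simplex has no points, so it lies vacuously in `s`; otherwise the ball around
        -- the vertex `w 0` contains the affine simplex.
        cases k with
        | zero => exact Or.inl fun x => absurd (stdSimplex.sum_eq_one x) (by simp)
        | succ k =>
          obtain ⟨b, hb⟩ := hb (w 0) (Set.mem_univ _)
          have : ∀ x, (σ.comp (aff w)) x ∈ cond b s t := fun x =>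
            hb ((dist_aff_le (fun i => hw i 0) x).trans_lt (hN m hm))
          cases b
          · exact Or.inr this
          · exact Or.inl this
      -- The initial mesh is at most 1, the bound for the diameter of the simplex.
      · intro i j
        exact (Metric.dist_le_diam_of_mem (bounded_stdSimplex (Fin k)) (Subtype.coe_prop _)
          (Subtype.coe_prop _)).trans diam_stdSimplex_le
    rw [Finsupp.supported_union] at h1
    obtain ⟨x, hx, y, hy, h⟩ := Submodule.mem_sup.1 h1
    obtain ⟨u, rfl⟩ := exists_push_incl hx
    obtain ⟨v, rfl⟩ := exists_push_incl hy
    refine ⟨r • u, r • v, ?_⟩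
    rw [map_smul, map_smul, ← smul_add, h, ← map_smul, Finsupp.smul_single, smul_eq_mul, mul_one]

end Small

/-! ### The topology of mapping cones -/

section ConeTopology

variable {X Y : Type u} [TopologicalSpace X] [TopologicalSpace Y] {T : Type v}

/-- The canonical map `X × I → Cone(X)`. -/
abbrev coneMk (X : Type u) [TopologicalSpace X] : C(X × unitInterval, ConeOn X) :=
  Collapse.mk _

/-- The apex of `Cone(X)`. -/
abbrev apex (X : Type u) [TopologicalSpace X] : ConeOn X :=
  Collapse.pt _

/-- The canonical map `X × I → Cone_f`. -/
def prMap (f : C(X, Y)) : C(X × unitInterval, TopCone f) :=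
  (Collapse.mk _).comp (Cyl.ofProd f)

/-- The apex of `Cone_f`. -/
abbrev apexOf (f : C(X, Y)) : TopCone f :=
  Collapse.pt _

theorem coneMk_zero (x : X) : coneMk X (x, 0) = apex X :=
  Collapse.mk_eq_pt (A := {p : X × unitInterval | p.2 = 0}) rfl

theorem prMap_zero (f : C(X, Y)) (x : X) : prMap f (x, 0) = apexOf f :=
  Collapse.mk_eq_pt ⟨(x, 0), rfl, rfl⟩

theorem prMap_one (f : C(X, Y)) (x : X) : prMap f (x, 1) = iMap f (f x) :=
  congrArg (Collapse.mk _) (Quot.sound ⟨x, rfl, rfl⟩ : Cyl.ofProd f (x, 1) = Cyl.ofTarget f (f x))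

@[simp]
theorem jMap_coneMk (f : C(X, Y)) (p : X × unitInterval) : jMap f (coneMk X p) = prMap f p := rfl

@[simp]
theorem jMap_apex (f : C(X, Y)) : jMap f (apex X) = apexOf f := rfl

theorem coneOn_ind {P : ConeOn X → Prop} (h : ∀ p, P (coneMk X p)) (h0 : P (apex X))
    (z : ConeOn X) : P z := by
  obtain ⟨a, rfl⟩ := Quot.exists_rep z
  rcases a with p | ⟨⟩
  · exact h p
  · exact h0

theorem topCone_ind {f : C(X, Y)} {P : TopCone f → Prop} (h : ∀ p, P (prMap f p))
    (hY : ∀ y, P (iMap f y)) (h0 : P (apexOf f)) (z : TopCone f) : P z := by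
  obtain ⟨a, rfl⟩ := Quot.exists_rep z
  rcases a with a | ⟨⟩
  · obtain ⟨b, rfl⟩ := Quot.exists_rep a
    rcases b with p | y
    · exact h p
    · exact hY y
  · exact h0

/-- The adjoined point is isolated before the collapse, so it imposes no condition on open sets. -/
theorem coneOn_isOpen_iff {s : Set (ConeOn X)} : IsOpen s ↔ IsOpen (coneMk X ⁻¹' s) := by
  refine (isQuotientMap_quot_mk.isOpen_preimage (s := s)).symm.trans (isOpen_sum_iff.trans ?_)
  exact and_iff_left (isOpen_discrete _)

theorem topCone_isOpen_iff {f : C(X, Y)} {s : Set (TopCone f)} :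
    IsOpen s ↔ IsOpen (prMap f ⁻¹' s) ∧ IsOpen (iMap f ⁻¹' s) := by
  refine (isQuotientMap_quot_mk.isOpen_preimage (s := s)).symm.trans (isOpen_sum_iff.trans ?_)
  refine (and_iff_left (isOpen_discrete _)).trans ?_
  exact (isQuotientMap_quot_mk.isOpen_preimage
    (s := Collapse.mk (Cyl.ofProd f '' {p | p.2 = 0}) ⁻¹' s)).symm.trans isOpen_sum_iff

/-- Functions out of `Cone(X)`. -/
def coneFun (a : X × unitInterval → T) (c : T) (h0 : ∀ x, a (x, 0) = c) : ConeOn X → T :=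
  Quot.lift (Sum.elim a fun _ => c) (by
    rintro _ _ ⟨⟨x, t⟩, ht, rfl, rfl⟩
    obtain rfl : t = 0 := ht
    exact h0 x)

/-- Functions out of `Cone_f`. -/
def topConeFun (f : C(X, Y)) (a : X × unitInterval → T) (b : Y → T) (c : T)
    (h1 : ∀ x, a (x, 1) = b (f x)) (h0 : ∀ x, a (x, 0) = c) : TopCone f → T :=
  Quot.lift (Sum.elim (Quot.lift (Sum.elim a b) (by
    rintro _ _ ⟨x, rfl, rfl⟩
    exact h1 x)) fun _ => c) (by
    rintro _ _ ⟨_, ⟨⟨x, t⟩, ht, rfl⟩, rfl, rfl⟩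
    obtain rfl : t = 0 := ht
    exact h0 x)

/-- Continuous maps out of `Cone(X)`. -/
def coneLift [TopologicalSpace T] (a : C(X × unitInterval, T)) (c : T)
    (h0 : ∀ x, a (x, 0) = c) : C(ConeOn X, T) where
  toFun := coneFun a c h0
  continuous_toFun := ⟨fun _ hs => coneOn_isOpen_iff.2 (hs.preimage a.continuous)⟩

/-- Continuous maps out of `Cone_f`. -/
def topConeLift [TopologicalSpace T] (f : C(X, Y)) (a : C(X × unitInterval, T)) (b : C(Y, T))
    (c : T) (h1 : ∀ x, a (x, 1) = b (f x)) (h0 : ∀ x, a (x, 0) = c) : C(TopCone f, T) where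
  toFun := topConeFun f a b c h1 h0
  continuous_toFun :=
    ⟨fun _ hs => topCone_isOpen_iff.2 ⟨hs.preimage a.continuous, hs.preimage b.continuous⟩⟩

/-- The height function on `Cone_f`. -/
def ht (f : C(X, Y)) : C(TopCone f, unitInterval) :=
  topConeLift f ⟨Prod.snd, continuous_snd⟩ (.const _ 1) 0 (fun _ => rfl) (fun _ => rfl)

@[simp] theorem ht_prMap (f : C(X, Y)) (p : X × unitInterval) : ht f (prMap f p) = p.2 := rfl
@[simp] theorem ht_iMap (f : C(X, Y)) (y : Y) : ht f (iMap f y) = 1 := rfl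
@[simp] theorem ht_apexOf (f : C(X, Y)) : ht f (apexOf f) = 0 := rfl

/-- The open cone in `Cone_f`. -/
def lowerSet (f : C(X, Y)) : Set (TopCone f) := {z | ht f z ≠ 1}

/-- An open neighbourhood of `Y` in `Cone_f`. -/
def upperSet (f : C(X, Y)) : Set (TopCone f) := {z | (1 / 2 : ℝ) < ht f z}

theorem isOpen_lowerSet (f : C(X, Y)) : IsOpen (lowerSet f) :=
  isOpen_ne.preimage (ht f).continuous

theorem isOpen_upperSet (f : C(X, Y)) : IsOpen (upperSet f) :=
  isOpen_lt continuous_const (continuous_subtype_val.comp (ht f).continuous)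

theorem lower_union_upper (f : C(X, Y)) : lowerSet f ∪ upperSet f = Set.univ := by
  refine Set.eq_univ_of_forall fun z => ?_
  by_cases h : ht f z = 1
  · refine Or.inr ?_
    change (1 / 2 : ℝ) < ht f z
    rw [h]
    norm_num
  · exact Or.inl h

open Classical in
/-- The retraction of the complement of the apex onto `Y`. -/
noncomputable def retrFun (f : C(X, Y)) : TopCone f → Option Y :=
  topConeFun f (fun p => if p.2 = 0 then none else some (f p.1)) some none
    (fun _ => if_neg one_ne_zero) (fun _ => if_pos rfl)

open Classical in
/-- The inverse of the map from the open cone on `X` to `Cone_f`. -/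
noncomputable def sectFun (f : C(X, Y)) : TopCone f → Option (ConeOn X) :=
  topConeFun f (fun p => if p.2 = 1 then none else some (coneMk X p)) (fun _ => none)
    (some (apex X)) (fun _ => if_pos rfl)
    (fun x => (if_neg zero_ne_one).trans (congrArg some (coneMk_zero x)))

theorem retrFun_prMap (f : C(X, Y)) {p : X × unitInterval} (h : p.2 ≠ 0) :
    retrFun f (prMap f p) = some (f p.1) := if_neg h

theorem retrFun_iMap (f : C(X, Y)) (y : Y) : retrFun f (iMap f y) = some y := rfl

theorem sectFun_prMap (f : C(X, Y)) {p : X × unitInterval} (h : p.2 ≠ 1) :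
    sectFun f (prMap f p) = some (coneMk X p) := if_neg h

theorem sectFun_apexOf (f : C(X, Y)) : sectFun f (apexOf f) = some (apex X) := rfl

theorem ne_zero_of_half_lt {t : unitInterval} (h : (1 / 2 : ℝ) < t) : t ≠ 0 := by
  rintro rfl
  norm_num at h

theorem exists_retrFun (f : C(X, Y)) (z : upperSet f) : ∃ y, retrFun f z = some y := by
  obtain ⟨z, hz⟩ := z
  induction z using topCone_ind with
  | h p => exact ⟨_, retrFun_prMap f (ne_zero_of_half_lt hz)⟩
  | hY y => exact ⟨y, rfl⟩
  | h0 => exact absurd rfl (ne_zero_of_half_lt hz)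

theorem exists_sectFun (f : C(X, Y)) (z : lowerSet f) : ∃ w, sectFun f z = some w := by
  obtain ⟨z, hz⟩ := z
  induction z using topCone_ind with
  | h p => exact ⟨_, sectFun_prMap f hz⟩
  | hY y => exact absurd rfl hz
  | h0 => exact ⟨_, rfl⟩

/-- The retraction of a neighbourhood of `Y` in `Cone_f` onto `Y`. -/
noncomputable def retr (f : C(X, Y)) : C(upperSet f, Y) where
  toFun z := (exists_retrFun f z).choose
  continuous_toFun := by
    refine ⟨fun s hs => ?_⟩
    -- The preimage is written as an open set of the whole cone, using the `Option`-valued extension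
    -- of the retraction, so that openness can be tested on `X × I` and `Y`.
    have : IsOpen {z : TopCone f | (1 / 2 : ℝ) < ht f z ∧ ∃ y ∈ s, retrFun f z = some y} := by
      refine topCone_isOpen_iff.2 ⟨?_, ?_⟩
      · have h : IsOpen {p : X × unitInterval | (1 / 2 : ℝ) < p.2 ∧ f p.1 ∈ s} :=
          (isOpen_lt continuous_const (continuous_subtype_val.comp continuous_snd)).inter
            (hs.preimage (f.continuous.comp continuous_fst))
        convert h using 1
        ext p
        refine and_congr_right fun hp => ?_
        simp [retrFun_prMap f (ne_zero_of_half_lt hp)]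
      · convert hs using 1
        ext y
        change (1 / 2 : ℝ) < ((1 : unitInterval) : ℝ) ∧ (∃ y' ∈ s, some y = some y') ↔ _
        norm_num
    convert this.preimage continuous_subtype_val using 1
    ext z
    have hz := (exists_retrFun f z).choose_spec
    refine Iff.trans ?_ (and_iff_right z.2).symm
    constructor
    · exact fun h => ⟨_, h, hz⟩
    · rintro ⟨y, hy, h⟩
      obtain rfl := Option.some.inj (h.symm.trans hz)
      exact hy

theorem retrFun_eq (f : C(X, Y)) (z : upperSet f) : retrFun f z = some (retr f z) :=
  (exists_retrFun f z).choose_spec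

/-- The map from the open cone in `Cone_f` to `Cone(X)` which is a section of `j`. -/
noncomputable def sect (f : C(X, Y)) : C(lowerSet f, ConeOn X) where
  toFun z := (exists_sectFun f z).choose
  continuous_toFun := by
    refine ⟨fun s hs => ?_⟩
    have : IsOpen {z : TopCone f | ht f z ≠ 1 ∧ ∃ w ∈ s, sectFun f z = some w} := by
      refine topCone_isOpen_iff.2 ⟨?_, ?_⟩
      · have h : IsOpen {p : X × unitInterval | p.2 ≠ 1 ∧ coneMk X p ∈ s} :=
          (isOpen_ne.preimage continuous_snd).inter (hs.preimage (by fun_prop))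
        convert h using 1
        ext p
        refine and_congr_right fun hp => ?_
        simp [sectFun_prMap f hp]
      · convert isOpen_empty
        ext y
        simp
    convert this.preimage continuous_subtype_val using 1
    ext z
    have hz := (exists_sectFun f z).choose_spec
    refine Iff.trans ?_ (and_iff_right z.2).symm
    constructor
    · exact fun h => ⟨_, h, hz⟩
    · rintro ⟨y, hy, h⟩
      obtain rfl := Option.some.inj (h.symm.trans hz)
      exact hy

theorem sectFun_eq (f : C(X, Y)) (z : lowerSet f) : sectFun f z = some (sect f z) :=
  (exists_sectFun f z).choose_spec

theorem jMap_sect (f : C(X, Y)) (z : lowerSet f) : jMap f (sect f z) = z := by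
  have h := sectFun_eq f z
  obtain ⟨z, hz⟩ := z
  induction z using topCone_ind with
  | h p => rw [← Option.some.inj ((sectFun_prMap f hz).symm.trans h), jMap_coneMk]
  | hY y => exact absurd rfl hz
  | h0 => rw [← Option.some.inj ((sectFun_apexOf f).symm.trans h), jMap_apex]

theorem sect_jMap (f : C(X, Y)) (w : ConeOn X) (hw : jMap f w ∈ lowerSet f) :
    sect f ⟨jMap f w, hw⟩ = w := by
  have h := sectFun_eq f ⟨jMap f w, hw⟩
  induction w using coneOn_ind with
  | h p => exact (Option.some.inj ((sectFun_prMap f hw).symm.trans h)).symm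
  | h0 => exact (Option.some.inj ((sectFun_apexOf f).symm.trans h)).symm

theorem iMap_mem_upperSet (f : C(X, Y)) (y : Y) : iMap f y ∈ upperSet f := by
  change (1 / 2 : ℝ) < ((1 : unitInterval) : ℝ)
  norm_num

theorem retr_iMap (f : C(X, Y)) (y : Y) : retr f ⟨iMap f y, iMap_mem_upperSet f y⟩ = y :=
  (Option.some.inj ((retrFun_iMap f y).symm.trans (retrFun_eq f ⟨iMap f y, _⟩))).symm

/-- The height of a point of `Cone(X)` does not depend on `f`. Hence the retraction onto the base of
`Cone(X)` can be borrowed from the mapping cone of the identity of `X`. -/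
theorem ht_jMap (f : C(X, Y)) (w : ConeOn X) :
    ht (ContinuousMap.id X) (jMap (ContinuousMap.id X) w) = ht f (jMap f w) := by
  induction w using coneOn_ind <;> rfl

/-- The neighbourhood of the base of `Cone(X)` which is the preimage of that of `Y` in `Cone_f`. -/
abbrev upperCone (f : C(X, Y)) : Set (ConeOn X) := jMap f ⁻¹' upperSet f

/-- The retraction of a neighbourhood of the base of `Cone(X)` onto `X`. -/
noncomputable def coneRetr (f : C(X, Y)) : C(upperCone f, X) :=
  (retr (ContinuousMap.id X)).comp ⟨fun w => ⟨jMap (ContinuousMap.id X) w, by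
    have h : (1 / 2 : ℝ) < ht f (jMap f w) := w.2
    rw [← ht_jMap] at h
    exact h⟩, by fun_prop⟩

theorem coneRetr_coneMk (f : C(X, Y)) (p : X × unitInterval) (hp : coneMk X p ∈ upperCone f) :
    coneRetr f ⟨coneMk X p, hp⟩ = p.1 := by
  have h := retrFun_eq (ContinuousMap.id X) ⟨jMap (ContinuousMap.id X) (coneMk X p), hp⟩
  exact (Option.some.inj ((retrFun_prMap (ContinuousMap.id X)
    (ne_zero_of_half_lt hp)).symm.trans h)).symm

theorem retr_prMap (f : C(X, Y)) (p : X × unitInterval) (hp : prMap f p ∈ upperSet f) :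
    retr f ⟨prMap f p, hp⟩ = f p.1 :=
  (Option.some.inj ((retrFun_prMap f (ne_zero_of_half_lt hp)).symm.trans
    (retrFun_eq f ⟨prMap f p, hp⟩))).symm

theorem apex_notMem_upperCone (f : C(X, Y)) : apex X ∉ upperCone f :=
  fun h => absurd rfl (ne_zero_of_half_lt h)

/-- The restriction of `j` to neighbourhoods of the bases. -/
def jUpper (f : C(X, Y)) : C(upperCone f, upperSet f) :=
  ⟨fun w => ⟨jMap f w, w.2⟩, by fun_prop⟩

/-- The restriction of `j` to the open cones. -/
def jLower (f : C(X, Y)) : C((jMap f ⁻¹' lowerSet f : Set (ConeOn X)), lowerSet f) :=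
  ⟨fun w => ⟨jMap f w, w.2⟩, by fun_prop⟩

theorem retr_jUpper (f : C(X, Y)) : (retr f).comp (jUpper f) = f.comp (coneRetr f) := by
  ext ⟨w, hw⟩
  induction w using coneOn_ind with
  | h p =>
    refine (retr_prMap f p hw).trans ?_
    rw [ContinuousMap.comp_apply, coneRetr_coneMk]
  | h0 => exact absurd hw (apex_notMem_upperCone f)

/-- The inclusion of the base of `Cone(X)`. -/
def topMap (X : Type u) [TopologicalSpace X] : C(X, ConeOn X) :=
  (coneMk X).comp ⟨fun x => (x, 1), by fun_prop⟩

theorem jMap_comp_topMap (f : C(X, Y)) : (jMap f).comp (topMap X) = (iMap f).comp f := by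
  ext x
  exact prMap_one f x

/-- The inclusion of the base of `Cone(X)` in its neighbourhood. -/
def topUpper (f : C(X, Y)) : C(X, upperCone f) :=
  ⟨fun x => ⟨topMap X x, by
    change (1 / 2 : ℝ) < ((1 : unitInterval) : ℝ)
    norm_num⟩, by fun_prop⟩

theorem coneRetr_topUpper (f : C(X, Y)) : (coneRetr f).comp (topUpper f) = ContinuousMap.id X := by
  ext x
  exact coneRetr_coneMk f (x, 1) _

/-- The inclusion of `Y` in its neighbourhood. -/
def iUpper (f : C(X, Y)) : C(Y, upperSet f) :=
  ⟨fun y => ⟨iMap f y, iMap_mem_upperSet f y⟩, by fun_prop⟩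

theorem retr_iUpper (f : C(X, Y)) : (retr f).comp (iUpper f) = ContinuousMap.id Y := by
  ext y
  exact retr_iMap f y

/-- The stretching `t ↦ min ((1 + s) t) 1` of the unit interval. -/
noncomputable def stretchI (s t : unitInterval) : unitInterval :=
  ⟨min ((1 + s) * t) 1, le_min (mul_nonneg (add_nonneg zero_le_one s.2.1) t.2.1) zero_le_one,
    min_le_right _ _⟩

theorem continuous_stretchI : Continuous fun p : unitInterval × unitInterval =>
    stretchI p.1 p.2 :=
  Continuous.subtype_mk (by fun_prop) _

theorem stretchI_zero (s : unitInterval) : stretchI s 0 = 0 := by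
  apply Subtype.ext
  simp [stretchI]

theorem stretchI_one (s : unitInterval) : stretchI s 1 = 1 := by
  apply Subtype.ext
  simp [stretchI, s.2.1]

theorem zero_stretchI (t : unitInterval) : stretchI 0 t = t := by
  apply Subtype.ext
  simp [stretchI, t.2.2]

/-- At full stretch the factor is 2, which is why the collar is cut off at height 1/2. -/
theorem one_stretchI {t : unitInterval} (h : (1 / 2 : ℝ) < t) : stretchI 1 t = 1 := by
  apply Subtype.ext
  simp only [stretchI, Set.Icc.coe_one, inf_eq_right]
  linarith

/-- The stretching of `Cone(X)`. -/
noncomputable def coneStretch (X : Type u) [TopologicalSpace X] : C(ConeOn X, ConeOn X) :=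
  coneLift ((coneMk X).comp ⟨fun p => (p.1, stretchI 1 p.2),
      continuous_fst.prodMk (continuous_stretchI.comp (continuous_const.prodMk continuous_snd))⟩)
    (apex X) (fun x => by
      change coneMk X (x, stretchI 1 0) = _
      rw [stretchI_zero, coneMk_zero])

/-- The family of stretchings of `Cone_f`. -/
noncomputable def stretchFamily (f : C(X, Y)) : C(TopCone f, C(unitInterval, TopCone f)) :=
  topConeLift f
    -- Currying gives a map out of `Cone_f` itself, to which the quotient property applies; joint
    -- continuity is recovered by evaluation because the interval is locally compact. This avoids
    -- asking whether the product of a quotient map with `I` is a quotient map.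
    (ContinuousMap.curry ((prMap f).comp ⟨fun p => (p.1.1, stretchI p.2 p.1.2),
      (continuous_fst.comp continuous_fst).prodMk (continuous_stretchI.comp
        (continuous_snd.prodMk (continuous_snd.comp continuous_fst)))⟩))
    (ContinuousMap.curry ((iMap f).comp ⟨Prod.fst, continuous_fst⟩))
    (ContinuousMap.const _ (apexOf f))
    (fun x => by
      ext s
      change prMap f (x, stretchI s 1) = iMap f (f x)
      rw [stretchI_one, prMap_one])
    (fun x => by
      ext s
      change prMap f (x, stretchI s 0) = apexOf f
      rw [stretchI_zero, prMap_zero])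

/-- The stretching of `Cone_f`. -/
noncomputable def topStretch (f : C(X, Y)) : C(TopCone f, TopCone f) :=
  ⟨fun z => stretchFamily f z 1, by fun_prop⟩

/-- The stretching of `Cone_f` is homotopic to the identity. -/
noncomputable def stretchHomotopy (f : C(X, Y)) :
    ContinuousMap.Homotopy (ContinuousMap.id (TopCone f)) (topStretch f) where
  toFun p := stretchFamily f p.2 p.1
  continuous_toFun := by fun_prop
  map_zero_left z := by
    induction z using topCone_ind with
    | h p =>
      change prMap f (p.1, stretchI 0 p.2) = _
      rw [zero_stretchI]
      rfl
    | hY y => rfl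
    | h0 => rfl
  map_one_left z := rfl

theorem jMap_coneStretch (f : C(X, Y)) :
    (jMap f).comp (coneStretch X) = (topStretch f).comp (jMap f) := by
  ext w
  induction w using coneOn_ind <;> rfl

/-- Full stretching pushes the collar onto `Y`. Hence, after inclusion in the cone, the retraction
becomes homotopic to the identity. -/
theorem iMap_retr (f : C(X, Y)) :
    (iMap f).comp (retr f) = (topStretch f).comp (incl (upperSet f)) := by
  ext ⟨z, hz⟩
  induction z using topCone_ind with
  | h p =>
    rw [ContinuousMap.comp_apply, retr_prMap, ← prMap_one]
    change _ = prMap f (p.1, stretchI 1 p.2)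
    rw [one_stretchI (t := p.2) hz]
  | hY y =>
    rw [ContinuousMap.comp_apply, retr_iMap]
    rfl
  | h0 => exact absurd rfl (ne_zero_of_half_lt hz)

theorem topMap_coneRetr (f : C(X, Y)) :
    (topMap X).comp (coneRetr f) = (coneStretch X).comp (incl (upperCone f)) := by
  ext ⟨w, hw⟩
  induction w using coneOn_ind with
  | h p =>
    rw [ContinuousMap.comp_apply, coneRetr_coneMk]
    change _ = coneMk X (p.1, stretchI 1 p.2)
    rw [one_stretchI (t := p.2) hw]
    rfl
  | h0 => exact absurd hw (apex_notMem_upperCone f)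

/-- The contraction `([x, s], t) ↦ [x, s t]` of a cone. -/
def coneContract (X : Type u) [TopologicalSpace X] : C(ConeOn (ConeOn X), ConeOn X) :=
  coneLift
    (ContinuousMap.uncurry (coneLift
      (ContinuousMap.curry ((coneMk X).comp ⟨fun p => (p.1.1, p.1.2 * p.2), by fun_prop⟩))
      (ContinuousMap.const _ (apex X))
      (fun x => by
        ext t
        change coneMk X (x, 0 * t) = _
        rw [zero_mul, coneMk_zero]
        rfl)))
    (apex X)
    (fun w => by
      induction w using coneOn_ind with
      | h p =>
        change coneMk X (p.1, p.2 * 0) = _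
        rw [mul_zero, coneMk_zero]
      | h0 => rfl)

theorem coneContract_topMap :
    (coneContract X).comp (topMap (ConeOn X)) = ContinuousMap.id (ConeOn X) := by
  ext w
  induction w using coneOn_ind with
  | h p =>
    change coneMk X (p.1, p.2 * 1) = _
    rw [mul_one]
    rfl
  | h0 => rfl

/-- The restriction of `sect` to the intersection of the two open sets, as a map to the
neighbourhood of the base of `Cone(X)`. -/
noncomputable def sectUpper (f : C(X, Y)) :
    C((lowerSet f ∩ upperSet f : Set (TopCone f)), upperCone f) :=
  ⟨fun z => ⟨sect f ⟨z, z.2.1⟩, by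
    rw [Set.mem_preimage, jMap_sect]
    exact z.2.2⟩, by fun_prop⟩

end ConeTopology

/-! ### Cones on singular chains -/

section ConeChains

variable {R : Type*} [CommRing R] {k : ℕ} {X Y : Type u} [TopologicalSpace X] [TopologicalSpace Y]

theorem faceMap_zero_eq (t : stdSimplex ℝ (Fin (k + 1))) :
    faceMap (0 : Fin (k + 2)) t = joinMap k (t, 1) := by
  apply Subtype.ext
  funext j
  change stdSimplex.map (Fin.succAbove 0) t j = 
    (Fin.cons (1 - (1 : ℝ)) (fun i => (1 : ℝ) * t i) : Fin (k + 2) → ℝ) j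
  rw [map_apply_eq]
  refine Fin.cases ?_ (fun j => ?_) j
  · simp
  · simp

theorem faceMap_succ_joinMap (i : Fin (k + 2)) (s : stdSimplex ℝ (Fin (k + 1)))
    (r : unitInterval) :
    faceMap i.succ (joinMap k (s, r)) = joinMap (k + 1) (faceMap i s, r) := by
  apply Subtype.ext
  funext j
  change stdSimplex.map (Fin.succAbove i.succ) (joinMap k (s, r)) j =
    (Fin.cons (1 - (r : ℝ)) (fun l => (r : ℝ) * stdSimplex.map i.succAbove s l) :
      Fin (k + 3) → ℝ) j
  have h0 : joinMap k (s, r) 0 = 1 - r := rfl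
  have h1 : ∀ l : Fin (k + 1), joinMap k (s, r) l.succ = r * s l := fun _ => rfl
  rw [map_apply_eq, Fin.sum_univ_succ]
  refine Fin.cases ?_ (fun j => ?_) j
  · simp [h0]
  · simp only [map_apply_eq, Fin.succ_succAbove_zero, Fin.succ_succAbove_succ, Fin.succ_inj, h1,
      Fin.cons_succ, Finset.mul_sum, mul_ite, mul_zero]
    rw [if_neg (Fin.succ_ne_zero j).symm, zero_add]

/-- The cone on a singular simplex; the cone on the empty simplex is the apex. -/
noncomputable def coneSimp : ∀ {k : ℕ}, C(stdSimplex ℝ (Fin k), X) →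
    C(stdSimplex ℝ (Fin (k + 1)), ConeOn X)
  | 0, _ => .const _ (apex X)
  | _ + 1, σ => coneSimplex σ

theorem coneSimp_comp_faceMap_zero (σ : C(stdSimplex ℝ (Fin k), X)) :
    (coneSimp σ).comp (faceMap 0) = (topMap X).comp σ := by
  cases k with
  | zero =>
    ext t
    exact absurd (stdSimplex.sum_eq_one t) (by simp)
  | succ k =>
    ext t
    change coneSimplexFun σ (faceMap 0 t) = _
    rw [faceMap_zero_eq, coneSimplexFun_joinMap]
    rfl

theorem coneSimp_comp_faceMap_succ (σ : C(stdSimplex ℝ (Fin (k + 1)), X)) (i : Fin (k + 1)) :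
    (coneSimp σ).comp (faceMap i.succ) = coneSimp (σ.comp (faceMap i)) := by
  ext t
  change coneSimplexFun σ (faceMap i.succ t) = _
  cases k with
  -- The proper face of the cone on a point is the apex, matching the cone on the empty simplex.
  | zero =>
    have : faceMap i.succ t = joinMap 0 (t, 0) := by
      obtain rfl : i = 0 := Fin.fin_one_eq_zero i
      apply Subtype.ext
      funext j
      change stdSimplex.map (Fin.succAbove 1) t j = 
        (Fin.cons (1 - (0 : ℝ)) (fun l => (0 : ℝ) * t l) : Fin 2 → ℝ) j
      have : t 0 = 1 := by simp
      rw [map_apply_eq, Fin.sum_univ_succ, Fin.sum_univ_zero, this]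
      fin_cases j <;> simp
    rw [this, coneSimplexFun_joinMap]
    exact coneMk_zero _
  | succ k =>
    obtain ⟨⟨s, r⟩, rfl⟩ := joinMap_surjective k t
    rw [faceMap_succ_joinMap, coneSimplexFun_joinMap]
    exact (coneSimplexFun_joinMap (σ.comp (faceMap i)) (s, r)).symm

/-- The cone operator on chains. -/
noncomputable def coneC : Chains R k X →ₗ[R] Chains R (k + 1) (ConeOn X) :=
  Finsupp.lmapDomain R R coneSimp

theorem coneC_single (σ : C(stdSimplex ℝ (Fin k), X)) :
    coneC (Finsupp.single σ (1 : R)) = Finsupp.single (coneSimp σ) 1 := by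
  simp [coneC]

/-- The face opposite the apex is the original simplex in the base of the cone; the remaining faces
are the cones on its faces with shifted sign. -/
theorem bd_coneC (c : Chains R (k + 1) X) : bd (coneC c) = push (topMap X) c - coneC (bd c) :=
  chains_ext (f := bd ∘ₗ coneC) (g := push (topMap X) - coneC ∘ₗ bd) (fun σ => by
    simp only [LinearMap.comp_apply, LinearMap.sub_apply, coneC_single, bd_single, push_single,
      map_sum, map_smul]
    rw [Fin.sum_univ_succ, coneSimp_comp_faceMap_zero, Fin.val_zero, pow_zero, one_smul,
      sub_eq_add_neg, ← Finset.sum_neg_distrib]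
    congr 1
    refine Finset.sum_congr rfl fun i _ => ?_
    rw [Fin.val_succ, pow_succ, mul_neg_one, neg_smul, coneSimp_comp_faceMap_succ]) c

theorem bd_coneC_zero (c : Chains R 0 X) : bd (coneC c) = push (topMap X) c :=
  chains_ext (f := bd ∘ₗ coneC) (g := push (topMap X)) (fun σ => by
    simp only [LinearMap.comp_apply, coneC_single, bd_single, push_single]
    simp [coneSimp_comp_faceMap_zero]) c

theorem IsCyc.bd_coneC {c : Chains R k X} (hc : IsCyc c) : bd (coneC c) = push (topMap X) c := by
  cases k with
  | zero => exact bd_coneC_zero c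
  | succ k => rw [MapCone.bd_coneC, show bd c = 0 from hc, map_zero, sub_zero]

/-- The reduced homology of a cone vanishes. -/
theorem IsCyc.exists_bd_eq {c : Chains R k (ConeOn X)} (hc : IsCyc c) :
    ∃ b : Chains R (k + 1) (ConeOn X), bd b = c := by
  -- Cone off the cycle in `Cone(Cone(X))` and contract; on the base the contraction is the
  -- identity.
  refine ⟨push (coneContract X) (coneC c), ?_⟩
  rw [← push_bd, hc.bd_coneC, push_push, coneContract_topMap, push_id]

end ConeChains

/-! ### Comparison with the augmented singular chain complex -/

section Comparison

variable {R : Type u} [CommRing R] {k : ℕ} {X Y : Type u} [TopologicalSpace X] [TopologicalSpace Y]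

/-- The comparison from formal combinations of singular simplices to the augmented singular chain
complex. -/
noncomputable def toAug : ∀ k : ℕ, Chains R k X →ₗ[R] (augChains R X).X k
  | 0 => (Finsupp.linearCombination R (fun _ => (1 : R)) : Chains R 0 X →ₗ[R] R)
  | k + 1 => (Finsupp.linearCombination R fun σ => (ofSimplex R σ).hom (1 : R) :
      Chains R (k + 1) X →ₗ[R] (singularChains R X).X k)

/-- The inverse of the comparison. -/
noncomputable def ofAug : ∀ k : ℕ, (augChains R X).X k →ₗ[R] Chains R k X
  -- The unique map from the empty simplex is the generator in augmented degree `-1`.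
  | 0 => (Finsupp.lsingle (ContinuousMap.mk
      (fun t => absurd (stdSimplex.sum_eq_one t) (by simp)) (continuous_of_const fun t =>
        absurd (stdSimplex.sum_eq_one t) (by simp))) : R →ₗ[R] Chains R 0 X)
  | k + 1 => (descSimplex R fun σ => ModuleCat.ofHom (Finsupp.lsingle σ) :
      (singularChains R X).X k ⟶ ModuleCat.of R (Chains R (k + 1) X)).hom

theorem toAug_zero_single (σ : C(stdSimplex ℝ (Fin 0), X)) :
    toAug 0 (Finsupp.single σ (1 : R)) = (1 : R) := by
  have : Finsupp.linearCombination R (fun _ => (1 : R)) (Finsupp.single σ (1 : R)) = 1 := by simp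
  exact this

theorem toAug_succ_single (σ : C(stdSimplex ℝ (Fin (k + 1)), X)) :
    toAug (k + 1) (Finsupp.single σ (1 : R)) = (ofSimplex R σ).hom (1 : R) := by
  have : Finsupp.linearCombination R (fun σ => (ofSimplex R σ).hom (1 : R))
      (Finsupp.single σ (1 : R)) = (ofSimplex R σ).hom (1 : R) := by simp
  exact this

theorem descSimplex_ofSimplex_apply {n : ℕ} {T : ModuleCat.{u} R}
    (g : C(stdSimplex ℝ (Fin (n + 1)), X) → (ModuleCat.of R R ⟶ T))
    (σ : C(stdSimplex ℝ (Fin (n + 1)), X)) (r : R) :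
    (descSimplex R g).hom ((ofSimplex R σ).hom r) = (g σ).hom r := by
  rw [← ofSimplex_desc R g σ]
  rfl

theorem ofAug_toAug (c : Chains R k X) : ofAug k (toAug k c) = c := by
  refine chains_ext (f := ofAug k ∘ₗ toAug k) (g := LinearMap.id) (fun σ => ?_) c
  rw [LinearMap.comp_apply]
  cases k with
  | zero =>
    rw [toAug_zero_single]
    change Finsupp.single _ (1 : R) = Finsupp.single _ 1
    congr 1
    ext t
    exact absurd (stdSimplex.sum_eq_one t) (by simp)
  | succ k =>
    rw [toAug_succ_single]
    exact descSimplex_ofSimplex_apply _ σ 1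

/-- Morphisms out of singular chains which agree on simplices agree. -/
theorem singularChains_hom_ext {n : ℕ} {T : ModuleCat.{u} R} {a b : (singularChains R X).X n ⟶ T}
    (h : ∀ σ : C(stdSimplex ℝ (Fin (n + 1)), X),
      a.hom ((ofSimplex R σ).hom (1 : R)) = b.hom ((ofSimplex R σ).hom (1 : R))) : a = b := by
  apply SSet.chainComplex_hom_ext
  intro s
  have := h ((TopCat.of X).toSSetObjEquiv (.op (SimplexCategory.mk n)) s)
  rw [ofSimplex, Equiv.symm_apply_apply] at this
  apply ModuleCat.hom_ext
  exact LinearMap.ext_ring this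

theorem toAug_ofAug (c : (augChains R X).X k) : toAug k (ofAug k c) = c := by
  cases k with
  | zero =>
    have : ∀ (σ : C(stdSimplex ℝ (Fin 0), X)) (r : R),
        Finsupp.linearCombination R (fun _ => (1 : R)) (Finsupp.single σ r) = r := by simp
    exact this _ c
  | succ k =>
    have : ModuleCat.ofHom (toAug (k + 1) ∘ₗ ofAug (k + 1)) = 𝟙 ((singularChains R X).X k) := by
      refine singularChains_hom_ext fun σ => ?_
      have h : ofAug (k + 1) ((ofSimplex R σ).hom (1 : R)) = Finsupp.single σ (1 : R) :=
        descSimplex_ofSimplex_apply _ σ 1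
      change toAug (k + 1) (ofAug (k + 1) ((ofSimplex R σ).hom (1 : R))) = _
      rw [h, toAug_succ_single]
      rfl
    exact congrArg (fun φ => φ.hom c) this

theorem toAug_injective (k : ℕ) : Function.Injective (toAug k : Chains R k X →ₗ[R] _) :=
  Function.LeftInverse.injective ofAug_toAug

theorem toAug_surjective (k : ℕ) : Function.Surjective (toAug k : Chains R k X →ₗ[R] _) :=
  Function.RightInverse.surjective toAug_ofAug

theorem ofSimplex_d {n : ℕ} (σ : C(stdSimplex ℝ (Fin (n + 2)), X)) :
    ofSimplex R σ ≫ (singularChains R X).d (n + 1) n =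
      ∑ i : Fin (n + 2), (-1) ^ (i : ℕ) • ofSimplex R (σ.comp (faceMap i)) := by
  unfold ofSimplex
  rw [SSet.ιChainComplex_d]
  rfl

theorem ofSimplex_singularMap {n : ℕ} (f : C(X, Y)) (σ : C(stdSimplex ℝ (Fin (n + 1)), X)) :
    ofSimplex R σ ≫ (singularMap R f).f n = ofSimplex R (f.comp σ) := by
  unfold ofSimplex
  rw [SSet.ι_chainComplexMap_f]
  rfl

theorem toAug_bd (c : Chains R (k + 1) X) :
    toAug k (bd c) = ((augChains R X).d (k + 1) k).hom (toAug (k + 1) c) := by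
  refine chains_ext (f := toAug k ∘ₗ bd) (g := ((augChains R X).d (k + 1) k).hom ∘ₗ toAug (k + 1))
    (fun σ => ?_) c
  rw [LinearMap.comp_apply, LinearMap.comp_apply, toAug_succ_single, bd_single]
  cases k with
  | zero =>
    rw [Fin.sum_univ_one, Fin.val_zero, pow_zero, one_smul, toAug_zero_single]
    exact (descSimplex_ofSimplex_apply (fun _ => 𝟙 _) σ (1 : R)).symm
  | succ k =>
    have := congrArg (fun φ => φ.hom (1 : R)) (ofSimplex_d (R := R) σ)
    refine Eq.trans ?_ this.symm
    simp only [map_sum, map_smul, toAug_succ_single]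
    change _ =
      (∑ i : Fin (k + 2), (-1 : ℤ) ^ (i : ℕ) • ofSimplex R (σ.comp (faceMap i))).hom (1 : R)
    rw [ModuleCat.hom_sum, LinearMap.sum_apply]
    refine Finset.sum_congr rfl fun i _ => ?_
    rcases Nat.even_or_odd (i : ℕ) with h | h
    · rw [h.neg_one_pow, h.neg_one_pow, one_smul]
      exact one_smul R (_ : (singularChains R X).X k)
    · rw [h.neg_one_pow, h.neg_one_pow, neg_one_smul]
      exact neg_one_smul R (M := (singularChains R X).X k) _

theorem toAug_push (f : C(X, Y)) (c : Chains R k X) :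
    toAug k (push f c) = ((augMap R f).f k).hom (toAug k c) := by
  refine chains_ext (f := toAug k ∘ₗ push f) (g := ((augMap R f).f k).hom ∘ₗ toAug k)
    (fun σ => ?_) c
  rw [LinearMap.comp_apply, LinearMap.comp_apply, push_single]
  cases k with
  | zero => rw [toAug_zero_single, toAug_zero_single]; rfl
  | succ k =>
    rw [toAug_succ_single, toAug_succ_single]
    exact (congrArg (fun φ => φ.hom (1 : R)) (ofSimplex_singularMap (R := R) f σ)).symm

theorem toAug_coneC (c : Chains R k X) :
    toAug (k + 1) (coneC c) = (hMap R X k).hom (toAug k c) := by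
  refine chains_ext (f := toAug (k + 1) ∘ₗ coneC) (g := (hMap R X k).hom ∘ₗ toAug k)
    (fun σ => ?_) c
  rw [LinearMap.comp_apply, LinearMap.comp_apply, coneC_single, toAug_succ_single]
  cases k with
  | zero => rw [toAug_zero_single]; rfl
  | succ k =>
    rw [toAug_succ_single]
    exact (descSimplex_ofSimplex_apply (fun σ => ofSimplex R (coneSimplex σ)) σ (1 : R)).symm

/-- Homotopic maps induce the same map on reduced homology. -/
theorem IsCyc.exists_bd_eq_sub {f g : C(X, Y)} (H : ContinuousMap.Homotopy f g) {c : Chains R k X}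
    (hc : IsCyc c) : ∃ b : Chains R (k + 1) Y, bd b = push f c - push g c := by
  cases k with
  | zero =>
    refine ⟨0, ?_⟩
    rw [map_zero, eq_comm, sub_eq_zero]
    refine chains_ext (f := push f) (g := push g) (fun σ => ?_) c
    rw [push_single, push_single]
    congr 1
    ext t
    exact absurd (stdSimplex.sum_eq_one t) (by simp)
  | succ k =>
    let h : _root_.Homotopy (singularMap R f) (singularMap R g) :=
      TopCat.Homotopy.singularChainComplexFunctorObjMap (C := ModuleCat.{u} R)
        (f := TopCat.ofHom f) (g := TopCat.ofHom g) H (ModuleCat.of R R)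
    obtain ⟨b, hb⟩ := toAug_surjective (k + 2) ((h.hom k (k + 1)).hom (toAug (k + 1) c))
    refine ⟨b, toAug_injective (k + 1) ?_⟩
    rw [map_sub, toAug_push, toAug_push, toAug_bd, hb, eq_sub_iff_add_eq]
    have hk := congrArg (fun φ => φ.hom (toAug (k + 1) c)) (h.comm k)
    -- The term applying the homotopy to the boundary of `c` vanishes: in ordinary degree 0 there is
    -- no such term, and above it `c` is a cycle.
    have hd : (dNext k h.hom).hom (toAug (k + 1) c) = 0 := by
      cases k with
      | zero => rw [Homotopy.dNext_zero_chainComplex]; rfl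
      | succ k =>
        rw [Homotopy.dNext_succ_chainComplex]
        have h' : ((augChains R X).d (k + 2) (k + 1)).hom (toAug (k + 2) c) = 0 := by
          rw [← toAug_bd, show bd c = 0 from hc, map_zero]
        exact (congrArg (h.hom k (k + 1)).hom h').trans (map_zero _)
    rw [Homotopy.prevD_chainComplex] at hk
    refine Eq.trans ?_ hk.symm
    have h0 : ∀ x y z : (singularChains R Y).X k, x = 0 → y + z = x + y + z := by
      rintro x y z rfl
      rw [zero_add]
    exact h0 _ _ _ hd

end Comparison

/-! ### Chains of the mapping cone -/

section MappingCone

variable {R : Type u} [CommRing R] {k : ℕ} {X Y : Type u} [TopologicalSpace X] [TopologicalSpace Y]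

/-- The inclusion of an intersection in the first set. -/
def interLeft {Z : Type*} [TopologicalSpace Z] (s t : Set Z) : C((s ∩ t : Set Z), s) :=
  ⟨fun z => ⟨z, z.2.1⟩, by fun_prop⟩

/-- The inclusion of an intersection in the second set. -/
def interRight {Z : Type*} [TopologicalSpace Z] (s t : Set Z) : C((s ∩ t : Set Z), t) :=
  ⟨fun z => ⟨z, z.2.2⟩, by fun_prop⟩

/-- Chains of two subspaces with the same image come from the intersection. -/
theorem exists_inter {Z : Type*} [TopologicalSpace Z] {s t : Set Z} {c : Chains R k s}
    {d : Chains R k t} (h : push (incl s) c = push (incl t) d) :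
    ∃ e : Chains R k (s ∩ t : Set Z), push (interLeft s t) e = c ∧ push (interRight s t) e = d := by
  obtain ⟨e, he⟩ := exists_of_push_eq h
  refine ⟨e, push_injective (incl_injective s) ?_, push_injective (incl_injective t) ?_⟩
  · rw [push_push]
    exact he
  · rw [push_push, ← h]
    exact he

/-- Retracting to `Y` and projecting to `X` agree through `f` on the overlap; this yields `f_* x =
∂y`. -/
theorem retr_interRight (f : C(X, Y)) :
    (retr f).comp (interRight (lowerSet f) (upperSet f)) =
      f.comp ((coneRetr f).comp (sectUpper f)) := by
  rw [← ContinuousMap.comp_assoc, ← retr_jUpper, ContinuousMap.comp_assoc]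
  congr 1
  ext z
  exact (jMap_sect f ⟨z, z.2.1⟩).symm

theorem topStretch_incl_lowerSet (f : C(X, Y)) :
    (topStretch f).comp (incl (lowerSet f)) = (jMap f).comp ((coneStretch X).comp (sect f)) := by
  rw [← ContinuousMap.comp_assoc, jMap_coneStretch, ContinuousMap.comp_assoc]
  congr 1
  ext z
  exact (jMap_sect f z).symm

theorem sect_jLower (f : C(X, Y)) : (sect f).comp (jLower f) = incl (jMap f ⁻¹' lowerSet f) := by
  ext w
  exact sect_jMap f w w.2

/-- Every cycle of the mapping cone of `f` is homologous to one coming from the algebraic mapping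
cone of `f_*`. -/
theorem exists_cycle_of_topCone (f : C(X, Y)) {z : Chains R (k + 1) (TopCone f)} (hz : bd z = 0) :
    ∃ (x : Chains R k X) (y : Chains R (k + 1) Y), IsCyc x ∧ push f x = bd y ∧
      ∃ c, z - (push (jMap f) (coneC x) - push (iMap f) y) = bd c := by
  obtain ⟨m, hm⟩ := exists_small (isOpen_lowerSet f) (isOpen_upperSet f) (lower_union_upper f) z
  obtain ⟨u, v, huv⟩ := hm m le_rfl
  have hcyc : IsCyc (k := k + 1) z := hz
  have hsd : bd (sdN m z) = 0 := isCyc_sdN hcyc m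
  -- Since `u + v` is a cycle, `∂u = -∂v` is supported in both open sets.
  obtain ⟨e, he, he'⟩ := exists_inter (R := R) (c := bd u) (d := -bd v) (by
    rw [huv, map_add, ← push_bd, ← push_bd] at hsd
    rw [map_neg, eq_neg_iff_add_eq_zero, hsd])
  have hecyc : IsCyc e := by
    refine isCyc_of_push (g := interLeft (lowerSet f) (upperSet f))
      (fun a b h => Subtype.ext (congrArg (fun z => z.1) h)) ?_
    rw [he]
    exact isCyc_bd u
  set p := (coneRetr f).comp (sectUpper f) with hp
  have hx : IsCyc (push p e) := isCyc_push hecyc p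
  refine ⟨push p e, -push (retr f) v, hx, ?_, ?_⟩
  · rw [push_push, ← retr_interRight, ← push_push, he', map_neg, map_neg, push_bd]
  -- The stretched lift of `u` and the cone on `x` have the same boundary, namely `x` in the base of
  -- `Cone(X)`; their difference bounds because the cone is acyclic.
  have hw : IsCyc (k := k + 1)
      (push ((coneStretch X).comp (sect f)) u - coneC (push p e)) := by
    change bd _ = 0
    rw [map_sub, hx.bd_coneC, ← push_bd, ← he, push_push, push_push, sub_eq_zero, hp,
      ← ContinuousMap.comp_assoc, topMap_coneRetr]
    rfl
  obtain ⟨c₁, hc₁⟩ := hw.exists_bd_eq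
  obtain ⟨c₂, hc₂⟩ := (isCyc_sdN hcyc m).exists_bd_eq_sub (stretchHomotopy f)
  -- The three terms account for subdividing `z`, stretching the result, and replacing the lift of
  -- `u` by the cone on `x`.
  refine ⟨hoN m z + c₂ + push (jMap f) c₁, ?_⟩
  rw [map_add, map_add, ← push_bd, hc₁, hc₂, hcyc.bd_hoN, push_id, map_sub, push_push,
    ← topStretch_incl_lowerSet, huv, map_add, push_push, push_push, map_neg, push_push,
    iMap_retr]
  abel

/-- A cycle of the algebraic mapping cone of `f_*` is a boundary if its image in the mapping cone
of `f` is. -/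
theorem exists_bd_of_topCone (f : C(X, Y)) {x : Chains R k X} {y : Chains R (k + 1) Y}
    (hx : IsCyc x) (hxy : push f x = bd y) {c : Chains R (k + 2) (TopCone f)}
    (hc : push (jMap f) (coneC x) - push (iMap f) y = bd c) :
    ∃ (θ : Chains R (k + 1) X) (η : Chains R (k + 2) Y),
      bd θ = x ∧ push f θ - bd η = y := by
  obtain ⟨m₁, hm₁⟩ := exists_small (isOpen_lowerSet f) (isOpen_upperSet f) (lower_union_upper f) c
  obtain ⟨m₂, hm₂⟩ := exists_small ((isOpen_lowerSet f).preimage (jMap f).continuous)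
    ((isOpen_upperSet f).preimage (jMap f).continuous)
    (by rw [← Set.preimage_union, lower_union_upper, Set.preimage_univ]) (coneC x)
  -- Both chains must be subdivided equally often, since subdivision of the relation `∂c = j_* h(x)
  -- - i_* y` is used below.
  obtain ⟨m, hm, hm'⟩ : ∃ m, m₁ ≤ m ∧ m₂ ≤ m := ⟨max m₁ m₂, le_max_left _ _, le_max_right _ _⟩
  obtain ⟨u, v, huv⟩ := hm₁ m hm
  obtain ⟨u', v', huv'⟩ := hm₂ m hm'
  -- The subdivided relation reads `∂u + ∂v = j_* u' + j_* v' - i_* sd y`. Collecting the open-cone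
  -- terms on one side and the collar terms on the other puts both sides in the overlap.
  obtain ⟨e, he, he'⟩ := exists_inter (R := R) (c := bd u - push (jLower f) u')
      (d := -bd v + push (jUpper f) v' - push (iUpper f) (sdN m y)) (by
    have h := bd_sdN m c
    rw [← hc, huv, map_add, map_sub, ← push_sdN, ← push_sdN, huv', map_add, ← push_bd,
      ← push_bd, push_push, push_push] at h
    simp only [map_sub, map_add, map_neg, push_push]
    have h1 : (incl (lowerSet f)).comp (jLower f) = (jMap f).comp (incl _) := rfl
    have h2 : (incl (upperSet f)).comp (jUpper f) = (jMap f).comp (incl _) := rfl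
    have h3 : (incl (upperSet f)).comp (iUpper f) = iMap f := rfl
    rw [h1, h2, h3, sub_eq_iff_eq_add, eq_sub_of_add_eq h]
    abel)
  -- Lifted to `Cone(X)`, `e` becomes the lift of `∂u` minus `u'`, with boundary `-∂u'`; now use
  -- `∂u' + ∂v' = sd x` in the base.
  have hkey : push (sectUpper f) (bd e) = bd v' - push (topUpper f) (sdN m x) := by
    refine push_injective (incl_injective (upperCone f)) ?_
    have h1 : (incl (upperCone f)).comp (sectUpper f) =
      (sect f).comp (interLeft (lowerSet f) (upperSet f)) := rfl
    have h2 : (incl (upperCone f)).comp (topUpper f) = topMap X := rfl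
    have h3 := bd_sdN m (coneC x)
    rw [huv', hx.bd_coneC, ← push_sdN, map_add] at h3
    rw [push_push, h1, ← push_push, push_bd, he, map_sub, bd_bd, zero_sub, map_neg, ← push_bd,
      push_push, sect_jLower, map_sub, push_push, h2, ← h3, push_bd, push_bd]
    abel
  have hp : push f (push ((coneRetr f).comp (sectUpper f)) e) =
      push (retr f) (-bd v + push (jUpper f) v' - push (iUpper f) (sdN m y)) := by
    rw [← he', push_push, push_push, retr_interRight]
  -- By `hkey`, the last two terms of `θ` have boundary `sd x`, and `hoN m x` supplies `x - sd x`.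
  -- In the second equation the contributions of `v` and `v'` cancel, leaving the homotopy formula
  -- for `y`.
  refine ⟨hoN m x + push (coneRetr f) v' - push ((coneRetr f).comp (sectUpper f)) e,
    push (retr f) v - hoN m y, ?_, ?_⟩
  · rw [map_sub, map_add, hx.bd_hoN, ← push_bd, ← push_bd, ← push_push, hkey, map_sub, push_push,
      coneRetr_topUpper, push_id]
    abel
  · have h := bd_hoN m y
    rw [map_sub, map_add, push_hoN, hxy, hp, push_push, ← retr_jUpper]
    simp only [map_sub, map_add, map_neg, push_push, retr_iUpper, push_id, ← push_bd]
    rw [eq_sub_iff_add_eq] at h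
    refine Eq.trans ?_ h
    abel

end MappingCone

/-! ### Homology isomorphisms from elements -/

section Elements

variable {R : Type u} [CommRing R]

/-- A morphism of short complexes of modules is a quasi-isomorphism if every cycle of the target
is homologous to the image of a cycle, and every cycle whose image is a boundary is a boundary. -/
theorem quasiIso_of_elements {S₁ S₂ : ShortComplex (ModuleCat.{v} R)} (φ : S₁ ⟶ S₂)
    (hs : ∀ z : S₂.X₂, S₂.g.hom z = 0 → ∃ w : S₁.X₂, S₁.g.hom w = 0 ∧
      ∃ c, z - φ.τ₂.hom w = S₂.f.hom c)
    (hi : ∀ w : S₁.X₂, S₁.g.hom w = 0 → ∀ c, φ.τ₂.hom w = S₂.f.hom c → ∃ b, w = S₁.f.hom b) :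
    ShortComplex.QuasiIso φ := by
  -- This models both homologies as kernels modulo ranges, so bijectivity can be checked on
  -- elements.
  have γ : ShortComplex.LeftHomologyMapData φ S₁.moduleCatLeftHomologyData
    S₂.moduleCatLeftHomologyData := default
  rw [γ.quasiIso_iff]
  let K : LinearMap.ker S₁.g.hom →ₗ[R] LinearMap.ker S₂.g.hom := γ.φK.hom
  let H : (LinearMap.ker S₁.g.hom ⧸ LinearMap.range S₁.moduleCatToCycles) →ₗ[R]
    (LinearMap.ker S₂.g.hom ⧸ LinearMap.range S₂.moduleCatToCycles) := γ.φH.hom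
  have hK (w : LinearMap.ker S₁.g.hom) : (K w).1 = φ.τ₂.hom w.1 :=
    congrArg (fun a => a.hom w) γ.commi
  have hH (w : LinearMap.ker S₁.g.hom) :
      H (Submodule.Quotient.mk w) = Submodule.Quotient.mk (K w) :=
    congrArg (fun a => a.hom w) γ.commπ
  have hb : Function.Bijective H := by
    constructor
    · rw [injective_iff_map_eq_zero]
      intro a ha
      obtain ⟨w, rfl⟩ := Submodule.Quotient.mk_surjective _ a
      rw [hH, Submodule.Quotient.mk_eq_zero] at ha
      obtain ⟨c, hc⟩ := ha
      obtain ⟨b, hb⟩ := hi w.1 w.2 c (by rw [← hK, ← hc]; rfl)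
      rw [Submodule.Quotient.mk_eq_zero]
      exact ⟨b, Subtype.ext hb.symm⟩
    · intro a
      obtain ⟨z, rfl⟩ := Submodule.Quotient.mk_surjective _ a
      obtain ⟨w, hw, c, hc⟩ := hs z.1 z.2
      refine ⟨Submodule.Quotient.mk ⟨w, hw⟩, ?_⟩
      rw [hH, eq_comm, Submodule.Quotient.eq]
      refine ⟨c, Subtype.ext ?_⟩
      change S₂.f.hom c = z.1 - (K ⟨w, hw⟩).1
      rw [hK, hc]
  exact (ConcreteCategory.isIso_iff_bijective γ.φH).2 hb

/-- An isomorphism between the homologies of two chain complexes from a morphism of short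
complexes which is bijective on homology classes. -/
theorem nonempty_homology_iso {K L : ChainComplex (ModuleCat.{v} R) ℕ} {i j k i' j' k' : ℕ}
    (hi : (ComplexShape.down ℕ).prev j = i) (hk : (ComplexShape.down ℕ).next j = k)
    (hi' : (ComplexShape.down ℕ).prev j' = i') (hk' : (ComplexShape.down ℕ).next j' = k')
    (φ : K.sc' i j k ⟶ L.sc' i' j' k') (hφ : ShortComplex.QuasiIso φ) :
    Nonempty (K.homology j ≅ L.homology j') :=
  ⟨ShortComplex.homologyMapIso (K.isoSc' i j k hi hk) ≪≫ asIso (ShortComplex.homologyMap φ) ≪≫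
    (ShortComplex.homologyMapIso (L.isoSc' i' j' k' hi' hk')).symm⟩

theorem next_succ_eq (k : ℕ) : (ComplexShape.down ℕ).next (k + 1) = k :=
  ChainComplex.next_nat_succ k

theorem next_zero_eq : (ComplexShape.down ℕ).next 0 = 0 :=
  ChainComplex.next_nat_zero

theorem prev_eq (k : ℕ) : (ComplexShape.down ℕ).prev k = k + 1 :=
  ChainComplex.prev ℕ k

theorem down_d_zero (K : ChainComplex (ModuleCat.{v} R) ℕ) (j : ℕ) : K.d 0 j = 0 :=
  K.shape _ _ (by simp)

end Elements

/-! ### The map from the algebraic to the topological mapping cone -/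

section Main

variable {R : Type u} [CommRing R]

section AlgCone

variable {K L : ChainComplex (ModuleCat.{v} R) ℕ} (φ : K ⟶ L)

theorem algCone_d (n : ℕ) : (algCone φ).d (n + 1) n = algConeD φ n :=
  ChainComplex.of_d _ _ _

theorem algCone_d_zero_apply (x : K.X 0) (y : L.X 1) :
    ((algCone φ).d 1 0).hom (x, y) = (φ.f 0).hom x - (L.d 1 0).hom y := by
  rw [algCone_d]
  rfl

theorem algCone_d_succ_apply (n : ℕ) (x : K.X (n + 1)) (y : L.X (n + 2)) :
    ((algCone φ).d (n + 2) (n + 1)).hom (x, y) =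
      ((K.d (n + 1) n).hom x, (φ.f (n + 1)).hom x - (L.d (n + 2) (n + 1)).hom y) := by
  rw [algCone_d]
  rfl

end AlgCone

variable {X Y : Type u} [TopologicalSpace X] [TopologicalSpace Y] (f : C(X, Y))

theorem lMap_zero_toAug (y : Chains R 0 Y) :
    (lMap R f 0).hom (toAug 0 y) = -toAug 0 (push (iMap f) y) := by
  rw [toAug_push]
  rfl

theorem lMap_succ_toAug (k : ℕ) (x : Chains R k X) (y : Chains R (k + 1) Y) :
    (lMap R f (k + 1)).hom (toAug k x, toAug (k + 1) y) =
      toAug (k + 1) (push (jMap f) (coneC x) - push (iMap f) y) := by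
  rw [map_sub, toAug_push, toAug_push, toAug_coneC]
  rfl

/-- The two squares for `l` anticommute. -/
theorem d_lMap_add_lMap_d (k : ℕ) :
    (algCone (augMap R f)).d (k + 1) k ≫ lMap R f k +
      lMap R f (k + 1) ≫ (augChains R (TopCone f)).d (k + 1) k = 0 := by
  apply ModuleCat.hom_ext
  apply LinearMap.ext
  rintro ⟨x, y⟩
  obtain ⟨x, rfl⟩ := toAug_surjective k x
  obtain ⟨y, rfl⟩ := toAug_surjective (k + 1) y
  change (lMap R f k).hom (((algCone (augMap R f)).d (k + 1) k).hom (toAug k x, toAug (k + 1) y)) +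
    ((augChains R (TopCone f)).d (k + 1) k).hom
      ((lMap R f (k + 1)).hom (toAug k x, toAug (k + 1) y)) = 0
  rw [lMap_succ_toAug, ← toAug_bd]
  cases k with
  | zero =>
    rw [algCone_d_zero_apply, ← toAug_push, ← toAug_bd, ← map_sub, lMap_zero_toAug, ← map_neg,
      ← map_add]
    simp only [map_sub, ← push_bd, bd_coneC_zero, push_push, jMap_comp_topMap]
    rw [neg_add_cancel, map_zero]
  | succ k =>
    rw [algCone_d_succ_apply, ← toAug_push, ← toAug_bd, ← toAug_bd, ← map_sub, lMap_succ_toAug,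
      ← map_add]
    simp only [map_sub, ← push_bd, bd_coneC, push_push, jMap_comp_topMap]
    rw [← map_zero (toAug (k + 1))]
    congr 1
    abel

/-- The chain map `(-1)ⁿ lₙ`. -/
noncomputable def lChainMap : algCone (augMap R f) ⟶ augChains R (TopCone f) where
  -- Here `k = n + 1`, so the sign differs from `(-1)ⁿ` by a global factor `-1`, harmless for both
  -- claims.
  f k := (-1 : ℤ) ^ k • lMap R f k
  comm' i j hij := by
    obtain rfl : j + 1 = i := hij
    have h := eq_neg_of_add_eq_zero_right (d_lMap_add_lMap_d (R := R) f j)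
    rw [Preadditive.zsmul_comp, h, Preadditive.comp_zsmul, pow_succ, mul_neg_one, neg_smul,
      smul_neg, neg_neg]

theorem neg_one_pow_smul_cancel {M : Type*} [AddCommGroup M] (k : ℕ) (a : M) :
    (-1 : ℤ) ^ k • (-1 : ℤ) ^ k • a = a := by
  rw [smul_smul, ← mul_pow, neg_one_mul, neg_neg, one_pow, one_smul]

theorem lMap_zero_bijective : Function.Bijective (lMap R f 0).hom := by
  have : ∀ r : R, (lMap R f 0).hom r = -r := fun _ => rfl
  refine ⟨fun a b h => neg_injective (G := R) h, fun b => ⟨(-b : R), neg_neg (G := R) b⟩⟩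

theorem quasiIso_lChainMap : QuasiIso (lChainMap (R := R) f) := by
  refine ⟨fun k => ?_⟩
  cases k with
  | zero =>
    rw [quasiIsoAt_iff' _ 1 0 0 (prev_eq 0) next_zero_eq]
    refine quasiIso_of_elements _ (fun z _ => ?_) (fun w _ c _ => ?_)
    · obtain ⟨w, rfl⟩ := (lMap_zero_bijective f).2 z
      refine ⟨w, congrArg (fun φ => φ.hom w) (down_d_zero (algCone (augMap R f)) 0), 0, ?_⟩
      refine Eq.trans (sub_eq_zero.2 ?_) (map_zero _).symm
      exact (congrArg (fun φ => φ.hom w) (one_smul ℤ (lMap R f 0))).symm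
    -- Everything in degree `-1` bounds, since `f_*` is the identity of `R` there.
    · refine ⟨((w : R), (0 : (augChains R Y).X 1)), ?_⟩
      refine Eq.trans ?_ (algCone_d_zero_apply (augMap R f) w 0).symm
      rw [map_zero, sub_zero]
      rfl
  | succ k =>
    rw [quasiIsoAt_iff' _ (k + 2) (k + 1) k (prev_eq (k + 1)) (next_succ_eq k)]
    have hcyc (x : Chains R k X) (y : Chains R (k + 1) Y) :
        ((algCone (augMap R f)).d (k + 1) k).hom (toAug k x, toAug (k + 1) y) = 0 ↔
          IsCyc x ∧ push f x = bd y := by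
      cases k with
      | zero =>
        rw [algCone_d_zero_apply, ← toAug_push, ← toAug_bd]
        refine sub_eq_zero.trans ((toAug_injective 0).eq_iff.trans ?_)
        exact ⟨fun h => ⟨trivial, h⟩, fun h => h.2⟩
      | succ k =>
        rw [algCone_d_succ_apply, ← toAug_push, ← toAug_bd, ← toAug_bd]
        refine Prod.ext_iff.trans (and_congr ?_ ?_)
        · exact map_eq_zero_iff _ (toAug_injective k)
        · exact sub_eq_zero.trans (toAug_injective (k + 1)).eq_iff
    have hL (w : (algCone (augMap R f)).X (k + 1)) : ((lChainMap f).f (k + 1)).hom w =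
      (-1 : ℤ) ^ (k + 1) • (lMap R f (k + 1)).hom w := rfl
    refine quasiIso_of_elements _ (fun z hz => ?_) (fun w hw c hc => ?_)
    · obtain ⟨z, rfl⟩ := toAug_surjective (k + 1) z
      obtain ⟨x, y, hx, hxy, c, hc⟩ := exists_cycle_of_topCone f
        (toAug_injective k (((toAug_bd z).trans hz).trans (map_zero _).symm))
      let w : (algCone (augMap R f)).X (k + 1) := (toAug k x, toAug (k + 1) y)
      have hw : ((algCone (augMap R f)).d (k + 1) k).hom w = 0 := (hcyc x y).2 ⟨hx, hxy⟩
      -- The extra sign cancels the one in `lChainMap`.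
      refine ⟨(-1 : ℤ) ^ (k + 1) • w, ?_, toAug (k + 2) c, ?_⟩
      · exact (map_zsmul ((algCone (augMap R f)).d (k + 1) k).hom _ w).trans
          ((congrArg _ hw).trans (smul_zero _))
      · refine Eq.trans ?_ ((congrArg (toAug (k + 1)) hc).trans (toAug_bd c))
        rw [map_sub]
        refine congrArg (fun a => toAug (k + 1) z - a) ?_
        refine (hL _).trans ?_
        rw [map_zsmul, neg_one_pow_smul_cancel]
        exact lMap_succ_toAug f k x y
    · obtain ⟨x, y⟩ := w
      obtain ⟨x, rfl⟩ := toAug_surjective k x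
      obtain ⟨y, rfl⟩ := toAug_surjective (k + 1) y
      obtain ⟨hx, hxy⟩ := (hcyc x y).1 hw
      obtain ⟨c, rfl⟩ := toAug_surjective (k + 2) c
      have h1 : (-1 : ℤ) ^ (k + 1) • toAug (k + 1) (push (jMap f) (coneC x) - push (iMap f) y) =
          toAug (k + 1) (bd c) := by
        rw [← lMap_succ_toAug, toAug_bd]
        exact hc
      obtain ⟨θ, η, rfl, rfl⟩ := exists_bd_of_topCone f hx hxy
        (c := (-1 : ℤ) ^ (k + 1) • c) (toAug_injective (k + 1) (by
          rw [map_zsmul, map_zsmul, ← h1, neg_one_pow_smul_cancel]))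
      refine ⟨(toAug (k + 1) θ, toAug (k + 2) η), ?_⟩
      refine Eq.trans ?_ (algCone_d_succ_apply (augMap R f) k _ _).symm
      rw [← toAug_push, ← toAug_bd, ← toAug_bd, ← map_sub]

end Main

/-! ### Relative homology of `f` and reduced homology of its mapping cone -/

section Relative

variable {R : Type u} [CommRing R] {X Y : Type u} [TopologicalSpace X] [TopologicalSpace Y]
  (f : C(X, Y))

/-- The comparison from the algebraic mapping cone of `f_*` on singular chains to the one on
augmented singular chains. -/
noncomputable def relToAug : ∀ n : ℕ,
    (algCone (singularMap R f)).X n ⟶ (algCone (augMap R f)).X (n + 1)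
  -- At index 1 the augmented cone is `R ⊕ S_0(Y)` with differential `(r, y) ↦ r - ε(y)`, so its
  -- cycles form the graph of the augmentation.
  | 0 => ModuleCat.ofHom ((augmentation R Y).hom.prod LinearMap.id :
      (singularChains R Y).X 0 →ₗ[R] R × (singularChains R Y).X 0)
  | n + 1 => 𝟙 (ModuleCat.of R ((singularChains R X).X n × (singularChains R Y).X (n + 1)))

theorem relToAug_comm (n : ℕ) :
    relToAug f (n + 1) ≫ (algCone (augMap R f)).d (n + 2) (n + 1) =
      (algCone (singularMap R f)).d (n + 1) n ≫ relToAug f n := by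
  apply ModuleCat.hom_ext
  apply LinearMap.ext
  rintro ⟨x, y⟩
  change ((algCone (augMap R f)).d (n + 2) (n + 1)).hom (x, y) =
    (relToAug f n).hom (((algCone (singularMap R f)).d (n + 1) n).hom (x, y))
  refine (algCone_d_succ_apply (augMap R f) n x y).trans ?_
  cases n with
  | zero =>
    rw [algCone_d_zero_apply]
    refine Prod.ext ?_ rfl
    change (augmentation R X).hom x = (augmentation R Y).hom
      (((singularMap R f).f 0).hom x - ((singularChains R Y).d 1 0).hom y)
    have h1 := congrArg (fun φ => φ.hom x) (singularMap_augmentation R f)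
    have h2 : (augmentation R Y).hom (((singularChains R Y).d 1 0).hom y) = 0 :=
      congrArg (fun φ => φ.hom y) (d_augmentation (X := Y) R)
    rw [map_sub, h2, sub_zero]
    exact h1.symm
  | succ n => exact (algCone_d_succ_apply (singularMap R f) n x y).symm

theorem relToAug_injective (n : ℕ) : Function.Injective (relToAug (R := R) f n).hom := by
  cases n with
  | zero => exact fun a b h => congrArg Prod.snd h
  | succ n => exact fun a b h => h

theorem relToAug_surjective (n : ℕ) : Function.Surjective (relToAug (R := R) f (n + 1)).hom :=
  fun a => ⟨a, rfl⟩

/-- The relative homology of `f` is the homology of the algebraic mapping cone of `f_*` on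
augmented chains. -/
theorem nonempty_relHomology_iso (n : ℕ) : Nonempty (relHomology (singularMap R f) n ≅
    (algCone (augMap R f)).homology (n + 1)) := by
  have hcomm (n : ℕ) (c) : (relToAug f n).hom (((algCone (singularMap R f)).d (n + 1) n).hom c) =
      ((algCone (augMap R f)).d (n + 2) (n + 1)).hom ((relToAug f (n + 1)).hom c) :=
    (congrArg (fun φ => φ.hom c) (relToAug_comm f n)).symm
  -- Injectivity in degree `n` and surjectivity one degree higher make boundaries correspond.
  have hinj (n : ℕ) (w) (c)
      (h : (relToAug f n).hom w = ((algCone (augMap R f)).d (n + 2) (n + 1)).hom c) :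
      ∃ b, w = ((algCone (singularMap R f)).d (n + 1) n).hom b := by
    obtain ⟨b, rfl⟩ := relToAug_surjective f n c
    exact ⟨b, relToAug_injective f n (h.trans (hcomm n b).symm)⟩
  cases n with
  | zero =>
    refine nonempty_homology_iso (prev_eq 0) next_zero_eq (prev_eq 1) (next_succ_eq 0)
      { τ₁ := relToAug f 1
        τ₂ := relToAug f 0
        -- The ordinary cone has zero differential out of degree 0, so compatibility only asks that
        -- the graph of the augmentation consist of cycles.
        τ₃ := 0
        comm₁₂ := relToAug_comm f 0
        comm₂₃ := ?_ } (quasiIso_of_elements _ (fun z hz => ?_) (fun w _ c hc => hinj 0 w c hc))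
    · rw [Limits.comp_zero]
      apply ModuleCat.hom_ext
      apply LinearMap.ext
      intro y
      refine (algCone_d_zero_apply (augMap R f) _ _).trans ?_
      exact sub_self (G := R) _
    · obtain ⟨r, y⟩ := z
      have hr : r = (augmentation R Y).hom y :=
        sub_eq_zero.1 ((algCone_d_zero_apply (augMap R f) r y).symm.trans hz)
      subst hr
      refine ⟨y, congrArg (fun φ => φ.hom y) (down_d_zero (algCone (singularMap R f)) 0), 0, ?_⟩
      exact (sub_self _).trans (map_zero _).symm
  | succ n =>
    refine nonempty_homology_iso (prev_eq (n + 1)) (next_succ_eq n) (prev_eq (n + 2))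
      (next_succ_eq (n + 1))
      { τ₁ := relToAug f (n + 2)
        τ₂ := relToAug f (n + 1)
        τ₃ := relToAug f n
        comm₁₂ := relToAug_comm f (n + 1)
        comm₂₃ := relToAug_comm f n }
      (quasiIso_of_elements _ (fun z hz => ?_) (fun w _ c hc => hinj (n + 1) w c hc))
    obtain ⟨w, rfl⟩ := relToAug_surjective f n z
    refine ⟨w, relToAug_injective f n ?_, 0, ?_⟩
    · exact (hcomm n w).trans (hz.trans (map_zero _).symm)
    · exact (sub_self _).trans (map_zero _).symm

/-- The relative homology of `f` is the reduced homology of its mapping cone. -/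
theorem nonempty_relHomology_iso_reducedHomology (n : ℕ) :
    Nonempty (relHomology (singularMap R f) n ≅ reducedHomology R (TopCone f) n) := by
  have := quasiIso_lChainMap (R := R) f
  obtain ⟨e⟩ := nonempty_relHomology_iso (R := R) f n
  exact ⟨e ≪≫ isoOfQuasiIsoAt (lChainMap f) (n + 1)⟩

/-- Reduced homology agrees with homology in positive degrees. -/
theorem nonempty_reducedHomology_iso (n : ℕ) :
    Nonempty (reducedHomology R X (n + 1) ≅ singularHomology R X (n + 1)) :=
  -- In positive degrees the two complexes have the same three-term piece, up to the index shift;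
  -- the augmentation does not enter.
  nonempty_homology_iso (K := augChains R X) (L := singularChains R X) (prev_eq (n + 2))
    (next_succ_eq (n + 1)) (prev_eq (n + 1)) (next_succ_eq n)
    (𝟙 ((singularChains R X).sc' (n + 2) (n + 1) n)) (inferInstanceAs (ShortComplex.QuasiIso
      (𝟙 ((singularChains R X).sc' (n + 2) (n + 1) n))))

end Relative

end MapCone

theorem mainTheorem10 {R : Type u} [CommRing R] {X Y : Type u} [TopologicalSpace X]
    [TopologicalSpace Y] (f : C(X, Y)) :
    (∀ k : ℕ,
      (MapCone.algCone (MapCone.augMap R f)).d (k + 1) k ≫ MapCone.lMap R f k +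
        MapCone.lMap R f (k + 1) ≫ (MapCone.augChains R (MapCone.TopCone f)).d (k + 1) k = 0) ∧
    (∃ L : MapCone.algCone (MapCone.augMap R f) ⟶ MapCone.augChains R (MapCone.TopCone f),
      (∀ k : ℕ, L.f k = (-1 : ℤ) ^ k • MapCone.lMap R f k) ∧ QuasiIso L) ∧
    (∀ n : ℕ, Nonempty (MapCone.relHomology (MapCone.singularMap R f) n ≅
      MapCone.reducedHomology R (MapCone.TopCone f) n)) ∧
    (∀ n : ℕ, 1 ≤ n → Nonempty (MapCone.relHomology (MapCone.singularMap R f) n ≅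
      MapCone.singularHomology R (MapCone.TopCone f) n)) := by
  refine ⟨MapCone.d_lMap_add_lMap_d f, ⟨MapCone.lChainMap f, fun _ => rfl,
    MapCone.quasiIso_lChainMap f⟩, MapCone.nonempty_relHomology_iso_reducedHomology f,
    fun n hn => ?_⟩
  obtain ⟨m, rfl⟩ := Nat.exists_eq_add_of_le' hn
  obtain ⟨e⟩ := MapCone.nonempty_relHomology_iso_reducedHomology (R := R) f (m + 1)
  obtain ⟨e'⟩ := MapCone.nonempty_reducedHomology_iso (R := R) (X := MapCone.TopCone f) m
  exact ⟨e ≪≫ e'⟩
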